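/- Let $k\ge 1$ be a constant and put $e=\frac{2^{k-1}-1}{2^k-1}$. Let $X,Y$ be finite sets, $|Y|=N\ge 1$, $|X|\ge kN$, and fix a commutative group operation $+$ on $Y$. A $k$-collision of $F:X\to Y$ is a set of $k$ distinct inputs with the same image. One quantum query to $F$ is one application of the unitary $|x,y\rangle\mapsto|x,y+F(x)\rangle$. The iterated Grover algorithm with query budget $B$ works as follows. Fix any $D\subseteq X$ with $|D|=kN$, and let $t_i=\lceil N^{(2^{k-i}-1)/(2^k-1)}\rceil$ for $1\le i\le k$ (so $t_k=1$). - Query $t_1$ distinct, uniformly random inputs from $D$; this gives the list $L_1$ of $t_1$ $1$-collisions with their images. - For $i=2,\dots,k$, let $F_i(x)=1$ if $x$ does not occur in $L_{i-1}$ but $F(x)$ is the image of an $(i-1)$-collision in $L_{i-1}$, and $F_i(x)=0$ otherwise. Run Grover search with an unknown number of solutions for $F_i$ on $D$ exactly $t_i$ times, always with the same $L_{i-1}$. Each $x$ that is found is added to an $(i-1)$-collision in $L_{i-1}$ with the same image, and the results form the list $L_i$. Give up if the same $i$-collision is found twice. - Output the $k$-collision in $L_k$. Here a Grover search starts with $m=1$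 and repeats the following: draw an integer $0\le j<m$ uniformly, apply $j$ Grover iterations to the uniform superposition over $D$, query, measure; stop if a solution is seen, otherwise replace $m$ by $\min(\frac65m,\sqrt{|D|})$. Each Grover iteration uses two queries to $F$. The whole algorithm gives up at the point where it would make more than $B$ queries; a single search also gives up after $B$ unsuccessful rounds (each round makes at least one query). **Theorem.** For every $k\ge1$ there is a constant $C>0$, depending only on $k$, such that the following holds for all $X$, $Y$, $+$, $D$ as above and every function $F:X\to Y$. 1. With $B=\lceil N^{e+1/2^k}\rceil$, the algorithm makes at most $C\,N^{e}$ quantum queries in expectation, and it outputs a $k$-collision of $F$ with probability at least $1-C\,N^{-1/2^k}$. 2. For every real $A\ge1$, with $B=\lceil A\,N^{e}\rceil$ the algorithm never makes more than $B$ queries, and it outputs a $k$-collision of $F$ with probability at least $1-\frac{C}{A}-C\,N^{-1/2^k}$. 3. For $1\le i\le k$, whenever the list $L_i$ is completed, it consists of exactly $t_i$ distinct $i$-collisions of $F$. -/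

import Mathlib

open scoped ENNReal

universe u v w w'

namespace MultiCollision

noncomputable section

/-! ### Quantum query programs -/

/-- Pure states of the two registers `|x, y⟩` (input register `X`, output register `Y`);
physical states are the unit vectors. -/
abbrev QState (X : Type u) (Y : Type v) : Type (max u v) := EuclideanSpace ℂ (X × Y)

/-- Unitary transformations of the two registers. -/
abbrev Gate (X : Type u) (Y : Type v) [Fintype X] [Fintype Y] : Type (max u v) :=
  QState X Y ≃ₗᵢ[ℂ] QState X Y

/-- The permutation `(x, y) ↦ (x, y + F x)` of the basis states. -/
def shiftPerm {X : Type u} {Y : Type v} [AddCommGroup Y] (F : X → Y) : Equiv.Perm (X × Y) where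
  toFun p := (p.1, p.2 + F p.1)
  invFun p := (p.1, p.2 - F p.1)
  left_inv p := by simp
  right_inv p := by simp

/-- The oracle of `F`: the unitary with `|x, y⟩ ↦ |x, y + F x⟩`. -/
def oracle {X : Type u} {Y : Type v} [Fintype X] [Fintype Y] [AddCommGroup Y] (F : X → Y) :
    Gate X Y :=
  LinearIsometryEquiv.piLpCongrLeft 2 ℂ ℂ (shiftPerm F)

/-- An instruction of a quantum circuit: a unitary that does not depend on the function that is
queried, or one query to that function. -/
inductive Instr (X : Type u) (Y : Type v) [Fintype X] [Fintype Y] : Type (max u v) where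
  | gate (U : Gate X Y) : Instr X Y
  | query : Instr X Y

/-- The unitary that an instruction performs when the oracle is that of `F`. -/
def Instr.toGate {X : Type u} {Y : Type v} [Fintype X] [Fintype Y] [AddCommGroup Y]
    (F : X → Y) : Instr X Y → Gate X Y
  | .gate U => U
  | .query => oracle F

/-- The state after the instructions of a circuit, the head of the list being performed first. -/
def evolve {X : Type u} {Y : Type v} [Fintype X] [Fintype Y] [AddCommGroup Y] (F : X → Y) :
    List (Instr X Y) → QState X Y → QState X Y
  | [], ψ => ψ
  | i :: c, ψ => evolve F c (i.toGate F ψ)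

/-- The number of queries in a circuit. -/
def queryCount {X : Type u} {Y : Type v} [Fintype X] [Fintype Y] : List (Instr X Y) → ℕ
  | [] => 0
  | .gate _ :: c => queryCount c
  | .query :: c => queryCount c + 1

theorem norm_evolve {X : Type u} {Y : Type v} [Fintype X] [Fintype Y] [AddCommGroup Y]
    (F : X → Y) (c : List (Instr X Y)) (ψ : QState X Y) : ‖evolve F c ψ‖ = ‖ψ‖ := by
  induction c generalizing ψ with
  | nil => rfl
  | cons i c ih => rw [evolve, ih, LinearIsometryEquiv.norm_map]

theorem sum_weights {X : Type u} {Y : Type v} [Fintype X] [Fintype Y] (ψ : QState X Y)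
    (hψ : ‖ψ‖ = 1) : ∑ p : X × Y, ENNReal.ofReal (‖ψ p‖ ^ 2) = 1 := by
  rw [← ENNReal.ofReal_sum_of_nonneg (fun _ _ => by positivity), ← EuclideanSpace.norm_sq_eq, hψ]
  simp

/-- Measurement of a unit vector in the computational basis: the outcome is `p` with
probability `|⟨p|ψ⟩|²`. -/
def measure {X : Type u} {Y : Type v} [Fintype X] [Fintype Y] (ψ : QState X Y)
    (hψ : ‖ψ‖ = 1) : PMF (X × Y) :=
  PMF.ofFintype (fun p => ENNReal.ofReal (‖ψ p‖ ^ 2)) (sum_weights ψ hψ)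

/-- Programs with classical control and randomness that have quantum query access to a function
`X → Y`. They see that function only through the queries in their circuits. -/
inductive QProg (X : Type u) (Y : Type v) [Fintype X] [Fintype Y] (α : Type w) :
    Type (max u v w) where
  /-- Stop with output `a`. -/
  | ret (a : α) : QProg X Y α
  /-- Draw `j` uniformly from `{0, …, n}`. -/
  | random (n : ℕ) (next : Fin (n + 1) → QProg X Y α) : QProg X Y α
  /-- Draw `x` uniformly from `s`. -/
  | pick (s : Finset X) (hs : s.Nonempty) (next : X → QProg X Y α) : QProg X Y α
  /-- Prepare the state `ψ`, run the circuit `c`, measure all registers. -/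
  | run (ψ : QState X Y) (hψ : ‖ψ‖ = 1) (c : List (Instr X Y)) (next : X × Y → QProg X Y α) :
      QProg X Y α

/-- Sequential composition of programs. -/
def QProg.bind {X : Type u} {Y : Type v} [Fintype X] [Fintype Y] {α : Type w} {β : Type w'} :
    QProg X Y α → (α → QProg X Y β) → QProg X Y β
  | .ret a, f => f a
  | .random n next, f => .random n fun j => (next j).bind f
  | .pick s hs next, f => .pick s hs fun x => (next x).bind f
  | .run ψ hψ c next, f => .run ψ hψ c fun p => (next p).bind f

/-- The program that behaves as the given one but gives up, with output `none`, at the point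
where it would make more than `B` queries in total. -/
def QProg.cutoff {X : Type u} {Y : Type v} [Fintype X] [Fintype Y] {α : Type w} :
    ℕ → QProg X Y (Option α) → QProg X Y (Option α)
  | _, .ret a => .ret a
  | B, .random n next => .random n fun j => (next j).cutoff B
  | B, .pick s hs next => .pick s hs fun x => (next x).cutoff B
  | B, .run ψ hψ c next =>
      if queryCount c ≤ B then .run ψ hψ c fun p => (next p).cutoff (B - queryCount c)
      else .ret none

/-- The joint distribution of the output of a program and of the number of queries it makes, when
the function that is queried is `F`. -/
def QProg.dist {X : Type u} {Y : Type v} [Fintype X] [Fintype Y] [AddCommGroup Y] {α : Type w}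
    (F : X → Y) : QProg X Y α → PMF (α × ℕ)
  | .ret a => PMF.pure (a, 0)
  | .random n next => (PMF.uniformOfFintype (Fin (n + 1))).bind fun j => (next j).dist F
  | .pick s hs next => (PMF.uniformOfFinset s hs).bind fun x => (next x).dist F
  | .run ψ hψ c next =>
      (measure (evolve F c ψ) ((norm_evolve F c ψ).trans hψ)).bind fun p =>
        ((next p).dist F).map fun r => (r.1, r.2 + queryCount c)

/-- The expected number of queries of a program, when the function that is queried is `F`. -/
def QProg.expectedQueries {X : Type u} {Y : Type v} [Fintype X] [Fintype Y] [AddCommGroup Y]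
    {α : Type w} (F : X → Y) (P : QProg X Y α) : ℝ≥0∞ :=
  ∑' r : α × ℕ, P.dist F r * (r.2 : ℝ≥0∞)

/-! ### Collisions -/

/-- `S` is a `k`-collision of `F`: `k` distinct inputs with the same image. -/
def IsKCollision {X : Type u} {Y : Type v} (F : X → Y) (k : ℕ) (S : Finset X) : Prop :=
  S.card = k ∧ ∀ x ∈ S, ∀ x' ∈ S, F x = F x'

/-- The probability that a program outputs a `k`-collision of the function `F` that it queries. -/
def QProg.successProb {X : Type u} {Y : Type v} [Fintype X] [Fintype Y] [AddCommGroup Y]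
    (F : X → Y) (k : ℕ) (P : QProg X Y (Option (Finset X))) : ℝ≥0∞ :=
  (P.dist F).toOuterMeasure {r | ∃ S, r.1 = some S ∧ IsKCollision F k S}

/-! ### Grover search with an unknown number of solutions -/

/-- The uniform superposition of the states `|x, 0⟩`, `x ∈ D`. -/
def uniformState {X : Type u} {Y : Type v} [Fintype X] [Fintype Y] [DecidableEq X]
    [DecidableEq Y] [AddCommGroup Y] (D : Finset X) : QState X Y :=
  WithLp.toLp 2 fun p => if p.1 ∈ D ∧ p.2 = 0 then (((Real.sqrt D.card)⁻¹ : ℝ) : ℂ) else 0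

theorem norm_uniformState {X : Type u} {Y : Type v} [Fintype X] [Fintype Y] [DecidableEq X]
    [DecidableEq Y] [AddCommGroup Y] (D : Finset X) (hD : D.Nonempty) :
    ‖(uniformState D : QState X Y)‖ = 1 := by
  have hpos : (0 : ℝ) < D.card := by exact_mod_cast hD.card_pos
  have h : ‖(uniformState D : QState X Y)‖ ^ 2 = 1 := by
    rw [EuclideanSpace.norm_sq_eq]
    have h1 : ∀ p : X × Y, ‖(uniformState D : QState X Y) p‖ ^ 2
        = if p ∈ D ×ˢ ({0} : Finset Y) then ((D.card : ℝ))⁻¹ else 0 := by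
      intro p
      have h2 : p ∈ D ×ˢ ({0} : Finset Y) ↔ p.1 ∈ D ∧ p.2 = 0 := by
        rw [Finset.mem_product, Finset.mem_singleton]
      by_cases hp : p.1 ∈ D ∧ p.2 = 0
      · rw [if_pos (h2.2 hp)]
        simp [uniformState, hp]
      · rw [if_neg (fun h => hp (h2.1 h))]
        simp only [uniformState, if_neg hp]
        simp
    simp only [h1]
    rw [Finset.sum_ite_mem, Finset.univ_inter, Finset.sum_const, Finset.card_product]
    simp [hpos.ne']
  nlinarith [norm_nonneg (uniformState D : QState X Y)]

theorem norm_basisState {X : Type u} {Y : Type v} [Fintype X] [Fintype Y] [DecidableEq X]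
    [DecidableEq Y] (p : X × Y) : ‖(EuclideanSpace.single p (1 : ℂ) : QState X Y)‖ = 1 := by
  simp

/-- A database: a list of multi-collisions, each stored with its common image. -/
abbrev Database (X : Type u) (Y : Type v) : Type (max u v) := List (Finset X × Y)

/-- `(x, y)` is marked with respect to the database `L` if `x` does not occur in `L` but `y` is
one of the images in `L`. With `y = F x` this is the function that is searched. -/
def Marked {X : Type u} {Y : Type v} (L : Database X Y) (p : X × Y) : Prop :=
  (∀ e ∈ L, p.1 ∉ e.1) ∧ ∃ e ∈ L, e.2 = p.2

instance {X : Type u} {Y : Type v} [DecidableEq X] [DecidableEq Y] (L : Database X Y)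
    (p : X × Y) : Decidable (Marked L p) := by
  unfold Marked; infer_instance

/-- The unitary `|x, y⟩ ↦ -|x, y⟩` for marked `(x, y)`, `|x, y⟩ ↦ |x, y⟩` for all others. -/
def phaseGate {X : Type u} {Y : Type v} [Fintype X] [Fintype Y] [DecidableEq X] [DecidableEq Y]
    (L : Database X Y) : Gate X Y :=
  LinearIsometryEquiv.piLpCongrRight 2 fun p =>
    if Marked L p then LinearIsometryEquiv.neg ℂ else LinearIsometryEquiv.refl ℂ ℂ

/-- The unitary `|x, y⟩ ↦ |x, -y⟩`. -/
def negGate {X : Type u} {Y : Type v} [Fintype X] [Fintype Y] [AddCommGroup Y] : Gate X Y :=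
  LinearIsometryEquiv.piLpCongrLeft 2 ℂ ℂ (Equiv.prodCongr (Equiv.refl X) (Equiv.neg Y))

/-- The unitary `2|s⟩⟨s| - 1`, where `|s⟩` is the uniform superposition over `D`. -/
def diffusionGate {X : Type u} {Y : Type v} [Fintype X] [Fintype Y] [DecidableEq X]
    [DecidableEq Y] [AddCommGroup Y] (D : Finset X) : Gate X Y :=
  (Submodule.span ℂ {(uniformState D : QState X Y)}).reflection

/-- One Grover iteration: the value `F x` is computed by one query, the phase is flipped, the
value is removed again by one query, then comes the diffusion. -/
def groverIteration {X : Type u} {Y : Type v} [Fintype X] [Fintype Y] [DecidableEq X]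
    [DecidableEq Y] [AddCommGroup Y] (D : Finset X) (L : Database X Y) : List (Instr X Y) :=
  [.query, .gate (phaseGate L), .gate negGate, .query, .gate negGate, .gate (diffusionGate D)]

/-- `j` Grover iterations and one more query, so that measuring afterwards gives a pair
`(x, F x)`. -/
def groverCircuit {X : Type u} {Y : Type v} [Fintype X] [Fintype Y] [DecidableEq X]
    [DecidableEq Y] [AddCommGroup Y] (D : Finset X) (L : Database X Y) (j : ℕ) :
    List (Instr X Y) :=
  (List.replicate j (groverIteration D L)).flatten ++ [.query]

/-- Grover search in `D`, with an unknown number of solutions, for an input that is marked with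
respect to `L`: draw `j` uniformly among the integers `0 ≤ j < m`, run `j` Grover iterations on
the uniform superposition, measure; stop if the result is marked, otherwise replace `m` by
`min (6 m / 5) √|D|` and repeat. There are at most `R` rounds. The search starts with `m = 1`. -/
def groverSearch {X : Type u} {Y : Type v} [Fintype X] [Fintype Y] [DecidableEq X]
    [DecidableEq Y] [AddCommGroup Y] (D : Finset X) (hD : D.Nonempty) (L : Database X Y) :
    ℕ → ℝ → QProg X Y (Option (X × Y))
  | 0, _ => .ret none
  | R + 1, m => .random (⌈m⌉₊ - 1) fun j =>
      .run (uniformState D) (norm_uniformState D hD) (groverCircuit D L j) fun p =>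
        if Marked L p then .ret (some p)
        else groverSearch D hD L R (min (6 / 5 * m) (Real.sqrt D.card))

/-! ### The multi-collision algorithm -/

/-- The size `t_i = N ^ ((2^(k-i) - 1) / (2^k - 1))`, rounded up, of the `i`-th database. -/
def listSize (k N i : ℕ) : ℕ :=
  ⌈(N : ℝ) ^ (((2 : ℝ) ^ (k - i) - 1) / ((2 : ℝ) ^ k - 1))⌉₊

/-- Add to `L` the input-output pairs of `n` random inputs from `D`, distinct from each other and
from those in `L`, with one query for each. -/
def sampleInputs {X : Type u} {Y : Type v} [Fintype X] [Fintype Y] [DecidableEq X]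
    [DecidableEq Y] [AddCommGroup Y] (D : Finset X) :
    ℕ → Database X Y → QProg X Y (Option (Database X Y))
  | 0, L => .ret (some L)
  | n + 1, L =>
      if h : (D.filter fun x => ∀ e ∈ L, x ∉ e.1).Nonempty then
        .pick _ h fun x =>
          .run (EuclideanSpace.single (x, (0 : Y)) 1) (norm_basisState _) [.query] fun p =>
            sampleInputs D n (({p.1}, p.2) :: L)
      else .ret none

/-- The collision that results from adding the input `x` with image `y` to the first
multi-collision in `L` with image `y`. -/
def extend {X : Type u} {Y : Type v} [DecidableEq X] [DecidableEq Y] (L : Database X Y)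
    (p : X × Y) : Option (Finset X × Y) :=
  (L.find? fun e => e.2 = p.2).map fun e => (insert p.1 e.1, p.2)

/-- Run Grover search `n` times with the same database `L`, and add the larger collisions that
result to `acc`; give up if a search fails or a collision is found a second time. -/
def collect {X : Type u} {Y : Type v} [Fintype X] [Fintype Y] [DecidableEq X]
    [DecidableEq Y] [AddCommGroup Y] (D : Finset X) (hD : D.Nonempty) (R : ℕ)
    (L : Database X Y) : ℕ → Database X Y → QProg X Y (Option (Database X Y))
  | 0, acc => .ret (some acc)
  | n + 1, acc => (groverSearch D hD L R 1).bind fun o =>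
      match o.bind (extend L) with
      | none => .ret none
      | some e => if e ∈ acc then .ret none else collect D hD R L n (e :: acc)

/-- `buildDatabase k D hD R i` builds the database `L_{i+1}`, a list of `t_{i+1}` distinct
`(i+1)`-collisions: `L_1` by sampling, and `L_{i+2}` by Grover searches that all use `L_{i+1}`. -/
def buildDatabase {X : Type u} {Y : Type v} [Fintype X] [Fintype Y] [DecidableEq X]
    [DecidableEq Y] [AddCommGroup Y] (k : ℕ) (D : Finset X) (hD : D.Nonempty) (R : ℕ) :
    ℕ → QProg X Y (Option (Database X Y))
  | 0 => sampleInputs D (listSize k (Fintype.card Y) 1) []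
  | i + 1 => (buildDatabase k D hD R i).bind fun o =>
      match o with
      | none => .ret none
      | some L => collect D hD R L (listSize k (Fintype.card Y) (i + 2)) []

/-- The iterated Grover algorithm on the domain `D` with at most `B` queries: it builds the
databases `L_1, …, L_k`, where `t_k = 1`, and outputs the single `k`-collision in `L_k`. Every
round of a search makes a query, so that `B` rounds are no restriction beyond that of `B`
queries. -/
def kCollisionFinder {X : Type u} {Y : Type v} [Fintype X] [Fintype Y] [DecidableEq X]
    [DecidableEq Y] [AddCommGroup Y] (k : ℕ) (D : Finset X) (B : ℕ) :
    QProg X Y (Option (Finset X)) :=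
  if hD : D.Nonempty then
    QProg.cutoff B <| (buildDatabase k D hD B (k - 1)).bind fun o =>
      .ret (o.bind fun L => L.head?.map Prod.fst)
  else .ret none

/-- `L` is a list of exactly `t` distinct `i`-collisions of `F`, each with its common image. -/
def IsCollisionList {X : Type u} {Y : Type v} (F : X → Y) (i t : ℕ) (L : Database X Y) : Prop :=
  L.length = t ∧ (L.map Prod.fst).Nodup ∧
    ∀ e ∈ L, IsKCollision F i e.1 ∧ ∀ x ∈ e.1, F x = e.2

/-- The exponent `(2^(k-1) - 1) / (2^k - 1)`. -/
def queryExponent (k : ℕ) : ℝ := ((2 : ℝ) ^ (k - 1) - 1) / ((2 : ℝ) ^ k - 1)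

end

end MultiCollision

/-! `F` is arbitrary, so its fibres may have very uneven sizes, and the length of a list by itself
controls neither the number of solutions of the next search nor the chance of finding something
twice. The analysis splits every fibre of `F` on `D` into blocks of `k` inputs and a remainder of
fewer than `k` (`nonempty_blockPartition`); the algorithm does not know the blocks. Since `D` has
`kN` inputs and there are `N` images, at least `N` inputs lie in full blocks (`card_le_card_full`).
Call `L_i` good if it occupies at most `i` inputs of each block and the image of at least `c t_i`
inputs in full blocks occurs in it. For `i < k` each full block over such an image has a free input,
so there are `Ω(t_i)` solutions, and a constant fraction of them lies in full blocks
(`le_card_markedSet`, `le_card_markedSet_full`).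

All solutions carry equal amplitude throughout a Grover search. Hence, with `K` solutions, each one
is found with probability at most `1/K`, at an expected cost of `O(√(kN/K))` queries
(`expect_groverSearch_le`, `expect_groverSearch_queries`). So the searches of one stage behave like
uniform draws of solutions. If the drawn inputs lie in distinct blocks, no collision is found twice
and every block gains at most one occupied input; if moreover a constant fraction of them lies in
full blocks, the new list is good. The supermartingale `potential` bounds the probability of the
opposite: `O(t_{i+1}²/t_i)` for a repeated block, `O(1/t_{i+1})` for too few full draws in a stage
before the last, and by Markov `O(N^e/B)` for an exhausted search. The first two are
`O(N^(-1/2^k))`. The exponents are such that each stage costs `O(N^e)` queries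
(`sizeExponent_add_eq`).

After a bad list nothing but the budget limits the cost, so quality and cost are tracked by one
quantity, `score`: it is `1` after a failure and the used fraction of the budget, capped at `1`,
otherwise. Its expectation grows by `O(N^(-1/2^k) + N^e/B)` per stage (`expect_score_succ_le`). It
bounds the failure probability of the algorithm with cutoff, and `B` times it bounds the expected
number of queries. -/

namespace MultiCollision

noncomputable section

/-! ### Expectations -/

/-- The expectation of a nonnegative function under a probability mass function. -/
def pmfExpect {α : Type w} (p : PMF α) (g : α → ℝ≥0∞) : ℝ≥0∞ := ∑' a, p a * g a

theorem pmfExpect_pure {α : Type w} (a : α) (g : α → ℝ≥0∞) : pmfExpect (PMF.pure a) g = g a := by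
  classical
  unfold pmfExpect
  rw [tsum_eq_single a]
  · simp
  · intro b hb
    simp [PMF.pure_apply, hb]

theorem pmfExpect_bind {α : Type w} {β : Type w'} (p : PMF α) (f : α → PMF β)
    (g : β → ℝ≥0∞) : pmfExpect (p.bind f) g = pmfExpect p fun a => pmfExpect (f a) g := by
  unfold pmfExpect
  simp_rw [PMF.bind_apply, ← ENNReal.tsum_mul_right, ← ENNReal.tsum_mul_left]
  rw [ENNReal.tsum_comm]
  simp_rw [mul_assoc]

theorem pmfExpect_map {α : Type w} {β : Type w'} (p : PMF α) (f : α → β) (g : β → ℝ≥0∞) :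
    pmfExpect (p.map f) g = pmfExpect p fun a => g (f a) := by
  unfold PMF.map
  rw [pmfExpect_bind]
  simp [pmfExpect_pure]

theorem pmfExpect_mono {α : Type w} (p : PMF α) {g h : α → ℝ≥0∞}
    (H : ∀ a ∈ p.support, g a ≤ h a) : pmfExpect p g ≤ pmfExpect p h := by
  refine ENNReal.tsum_le_tsum fun a => ?_
  by_cases ha : a ∈ p.support
  · exact mul_le_mul_right (H a ha) _
  · rw [PMF.mem_support_iff, not_not] at ha
    simp [ha]

theorem pmfExpect_const {α : Type w} (p : PMF α) (c : ℝ≥0∞) : pmfExpect p (fun _ => c) = c := by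
  unfold pmfExpect
  rw [ENNReal.tsum_mul_right, PMF.tsum_coe, one_mul]

theorem pmfExpect_add {α : Type w} (p : PMF α) (g h : α → ℝ≥0∞) :
    pmfExpect p (fun a => g a + h a) = pmfExpect p g + pmfExpect p h := by
  unfold pmfExpect
  simp_rw [mul_add]
  exact ENNReal.tsum_add

theorem pmfExpect_const_mul {α : Type w} (p : PMF α) (c : ℝ≥0∞) (g : α → ℝ≥0∞) :
    pmfExpect p (fun a => c * g a) = c * pmfExpect p g := by
  unfold pmfExpect
  rw [← ENNReal.tsum_mul_left]
  exact tsum_congr fun a => by ring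

theorem pmfExpect_uniformOfFintype {α : Type w} [Fintype α] [Nonempty α] (g : α → ℝ≥0∞) :
    pmfExpect (PMF.uniformOfFintype α) g = (∑ a, g a) / Fintype.card α := by
  unfold pmfExpect
  simp [tsum_fintype, ENNReal.div_eq_inv_mul, Finset.mul_sum]

theorem pmfExpect_uniformOfFinset {α : Type w} (s : Finset α) (hs : s.Nonempty)
    (g : α → ℝ≥0∞) :
    pmfExpect (PMF.uniformOfFinset s hs) g = (∑ a ∈ s, g a) / s.card := by
  unfold pmfExpect
  rw [tsum_eq_sum (s := s)]
  · rw [ENNReal.div_eq_inv_mul, Finset.mul_sum]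
    exact Finset.sum_congr rfl fun a ha => by rw [PMF.uniformOfFinset_apply_of_mem hs ha]
  · intro b hb
    rw [PMF.uniformOfFinset_apply_of_notMem hs hb, zero_mul]

/-! ### Expectations over runs of programs, and the query cutoff -/

section Programs

variable {X : Type u} {Y : Type v} [Fintype X] [Fintype Y] [AddCommGroup Y]

/-- The expectation of a function of the output and of the number of queries of a program. -/
def QProg.expect {α : Type w} (F : X → Y) (P : QProg X Y α) (g : α × ℕ → ℝ≥0∞) : ℝ≥0∞ :=
  pmfExpect (P.dist F) g

namespace QProg

variable {α : Type w} {β : Type w'} (F : X → Y)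

theorem expect_ret (a : α) (g : α × ℕ → ℝ≥0∞) :
    (QProg.ret a : QProg X Y α).expect F g = g (a, 0) := pmfExpect_pure _ _

theorem expect_random (n : ℕ) (next : Fin (n + 1) → QProg X Y α) (g : α × ℕ → ℝ≥0∞) :
    (QProg.random n next).expect F g = (∑ j, (next j).expect F g) / (n + 1 : ℕ) := by
  change pmfExpect ((PMF.uniformOfFintype (Fin (n + 1))).bind fun j => (next j).dist F) g = _
  rw [pmfExpect_bind, pmfExpect_uniformOfFintype, Fintype.card_fin]
  rfl

theorem expect_pick (s : Finset X) (hs : s.Nonempty) (next : X → QProg X Y α)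
    (g : α × ℕ → ℝ≥0∞) :
    (QProg.pick s hs next).expect F g = (∑ x ∈ s, (next x).expect F g) / s.card := by
  change pmfExpect ((PMF.uniformOfFinset s hs).bind fun x => (next x).dist F) g = _
  rw [pmfExpect_bind, pmfExpect_uniformOfFinset]
  rfl

theorem expect_run (ψ : QState X Y) (hψ : ‖ψ‖ = 1) (c : List (Instr X Y))
    (next : X × Y → QProg X Y α) (g : α × ℕ → ℝ≥0∞) :
    (QProg.run ψ hψ c next).expect F g = ∑ p, ENNReal.ofReal (‖evolve F c ψ p‖ ^ 2) *
      (next p).expect F fun r => g (r.1, r.2 + queryCount c) := by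
  change pmfExpect ((measure (evolve F c ψ) ((norm_evolve F c ψ).trans hψ)).bind fun p =>
        ((next p).dist F).map fun r => (r.1, r.2 + queryCount c)) g = _
  simp_rw [pmfExpect_bind, pmfExpect_map]
  exact tsum_fintype _

theorem expect_mono (P : QProg X Y α) {g h : α × ℕ → ℝ≥0∞}
    (H : ∀ r ∈ (P.dist F).support, g r ≤ h r) : P.expect F g ≤ P.expect F h :=
  pmfExpect_mono _ H

theorem expect_const (P : QProg X Y α) (c : ℝ≥0∞) : P.expect F (fun _ => c) = c :=
  pmfExpect_const _ _

theorem expect_le_of_le (P : QProg X Y α) {g : α × ℕ → ℝ≥0∞} {c : ℝ≥0∞} (H : ∀ r, g r ≤ c) :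
    P.expect F g ≤ c :=
  (expect_mono F P fun r _ => H r).trans_eq (expect_const F P c)

theorem expect_add (P : QProg X Y α) (g h : α × ℕ → ℝ≥0∞) :
    P.expect F (fun r => g r + h r) = P.expect F g + P.expect F h := pmfExpect_add _ _ _

theorem expect_const_mul (P : QProg X Y α) (c : ℝ≥0∞) (g : α × ℕ → ℝ≥0∞) :
    P.expect F (fun r => c * g r) = c * P.expect F g := pmfExpect_const_mul _ _ _

theorem expect_bind (P : QProg X Y α) (f : α → QProg X Y β) (g : β × ℕ → ℝ≥0∞) :
    (P.bind f).expect F g =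
      P.expect F fun r => (f r.1).expect F fun s => g (s.1, s.2 + r.2) := by
  induction P generalizing g with
  | ret a => simp [QProg.bind, expect_ret]
  | random n next ih => simp only [QProg.bind, expect_random, ih]
  | pick s hs next ih => simp only [QProg.bind, expect_pick, ih]
  | run ψ hψ c next ih => simp only [QProg.bind, expect_run, ih, add_assoc]

theorem mem_support_bind (P : QProg X Y α) (f : α → QProg X Y β) {r : β × ℕ}
    (hr : r ∈ ((P.bind f).dist F).support) :
    ∃ a ∈ (P.dist F).support, ∃ b ∈ ((f a.1).dist F).support, r = (b.1, b.2 + a.2) := by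
  induction P generalizing r with
  | ret a => exact ⟨(a, 0), by simp [dist], r, hr, rfl⟩
  | random n next ih =>
    simp only [QProg.bind, dist, PMF.mem_support_bind_iff] at hr ⊢
    obtain ⟨j, hj, hr⟩ := hr
    obtain ⟨a, ha, b, hb, h⟩ := ih j hr
    exact ⟨a, ⟨j, hj, ha⟩, b, hb, h⟩
  | pick s hs next ih =>
    simp only [QProg.bind, dist, PMF.mem_support_bind_iff] at hr ⊢
    obtain ⟨j, hj, hr⟩ := hr
    obtain ⟨a, ha, b, hb, h⟩ := ih j hr
    exact ⟨a, ⟨j, hj, ha⟩, b, hb, h⟩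
  | run ψ hψ c next ih =>
    simp only [QProg.bind, dist, PMF.mem_support_bind_iff, PMF.mem_support_map_iff] at hr ⊢
    obtain ⟨j, hj, r', hr, rfl⟩ := hr
    obtain ⟨a, ha, b, hb, rfl⟩ := ih j hr
    exact ⟨(a.1, a.2 + queryCount c), ⟨j, hj, a, ha, rfl⟩, b, hb, by simp [add_assoc]⟩

theorem cutoff_queries_le (B : ℕ) (P : QProg X Y (Option α)) :
    ∀ r ∈ ((P.cutoff B).dist F).support, r.2 ≤ B := by
  induction P generalizing B with
  | ret a => simp [cutoff, dist]
  | random n next ih =>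
    intro r hr
    simp only [cutoff, dist, PMF.mem_support_bind_iff] at hr
    obtain ⟨j, -, hr⟩ := hr
    exact ih j B r hr
  | pick s hs next ih =>
    intro r hr
    simp only [cutoff, dist, PMF.mem_support_bind_iff] at hr
    obtain ⟨j, -, hr⟩ := hr
    exact ih j B r hr
  | run ψ hψ c next ih =>
    intro r hr
    unfold cutoff at hr
    split_ifs at hr with h
    · simp only [dist, PMF.mem_support_bind_iff, PMF.mem_support_map_iff] at hr
      obtain ⟨p, -, r', hr, rfl⟩ := hr
      have := ih p _ r' hr
      dsimp only
      omega
    · simp [dist] at hr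
      simp [hr]

/-- A run with cutoff agrees with a run of `P` until the budget would be exceeded. The condition
`h₂` covers the abandoned runs: their output is `none` after some `n' ≤ B` queries, while every
continuation of `P` ends with more than `B`. -/
theorem expect_cutoff_le (B : ℕ) (P : QProg X Y (Option α)) {g h : Option α × ℕ → ℝ≥0∞}
    (h₁ : ∀ a, ∀ n ≤ B, g (a, n) ≤ h (a, n))
    (h₂ : ∀ a, ∀ n > B, ∀ n' ≤ B, g (none, n') ≤ h (a, n)) :
    (P.cutoff B).expect F g ≤ P.expect F h := by
  induction P generalizing B g h with
  | ret a => simpa [cutoff, expect_ret] using h₁ a 0 (Nat.zero_le _)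
  | random n next ih =>
    simp only [cutoff, expect_random]
    gcongr with j
    exact ih j B h₁ h₂
  | pick s hs next ih =>
    simp only [cutoff, expect_pick]
    gcongr with j
    exact ih j B h₁ h₂
  | run ψ hψ c next ih =>
    unfold cutoff
    split_ifs with hc
    · simp only [expect_run]
      gcongr with p
      refine ih p _ (fun a n hn => h₁ _ _ (by omega)) fun a n hn n' hn' => ?_
      exact h₂ _ _ (by omega) _ (by omega)
    -- The circuit alone exceeds the budget, so every run of the full program ends with more than
    -- `B` queries and `h₂` applies to each outcome.
    · rw [expect_ret, ← expect_const F (QProg.run ψ hψ c next) (g (none, 0)), expect_run,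
        expect_run]
      gcongr with p
      exact expect_mono F _ fun r _ => h₂ _ _ (by omega) _ (Nat.zero_le _)

end QProg

end Programs

/-! ### Grover iterations -/

section Grover

set_option linter.unusedSectionVars false

variable {X : Type u} {Y : Type v} [Fintype X] [Fintype Y] [DecidableEq X] [DecidableEq Y]
  [AddCommGroup Y] (F : X → Y) (D : Finset X) (L : Database X Y)

/-- The solutions in `D` of the search problem of `L`. -/
def markedSet : Finset X := D.filter fun x => Marked L (x, F x)

/-- The state with amplitude `a` on `|x, 0⟩` for solutions `x ∈ D`, and `b` for all other
`x ∈ D`. -/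
def twoLevelState (a b : ℝ) : QState X Y :=
  WithLp.toLp 2 fun p => if p.1 ∈ D ∧ p.2 = 0 then
    (if Marked L (p.1, F p.1) then (a : ℂ) else (b : ℂ)) else 0

theorem uniformState_eq_twoLevelState :
    (uniformState D : QState X Y) =
      twoLevelState F D L (Real.sqrt D.card)⁻¹ (Real.sqrt D.card)⁻¹ := by
  ext p
  simp [uniformState, twoLevelState]

theorem evolve_append (c d : List (Instr X Y)) (ψ : QState X Y) :
    evolve F (c ++ d) ψ = evolve F d (evolve F c ψ) := by
  induction c generalizing ψ with
  | nil => rfl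
  | cons i c ih => exact ih _

theorem queryCount_append (c d : List (Instr X Y)) :
    queryCount (c ++ d) = queryCount c + queryCount d := by
  induction c with
  | nil => simp [queryCount]
  | cons i c ih => cases i <;> simp [queryCount, ih]; omega

theorem queryCount_groverCircuit (j : ℕ) : queryCount (groverCircuit D L j) = 2 * j + 1 := by
  unfold groverCircuit
  rw [queryCount_append]
  congr 1
  induction j with
  | zero => rfl
  | succ j ih =>
    rw [List.replicate_succ, List.flatten_cons, queryCount_append, ih]
    simp [groverIteration, queryCount]
    omega

theorem oracle_apply (ψ : QState X Y) (x : X) (y : Y) :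
    oracle F ψ (x, y) = ψ (x, y - F x) := rfl

theorem negGate_apply (ψ : QState X Y) (x : X) (y : Y) :
    negGate ψ (x, y) = ψ (x, -y) := rfl

theorem phaseGate_apply (ψ : QState X Y) (p : X × Y) :
    phaseGate L ψ p = if Marked L p then -ψ p else ψ p := by
  unfold phaseGate
  rw [LinearIsometryEquiv.piLpCongrRight_apply]
  by_cases h : Marked L p <;> simp [h]

theorem inner_uniformState_twoLevelState (a b : ℝ) :
    inner ℂ (uniformState D : QState X Y) (twoLevelState F D L a b) =
      (((markedSet F D L).card * a + (D.card - (markedSet F D L).card) * b) /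
        Real.sqrt D.card : ℝ) := by
  have hsum : (∑ x ∈ D, if Marked L (x, F x) then a else b) =
      (markedSet F D L).card * a + (D.card - (markedSet F D L).card) * b := by
    rw [Finset.sum_ite, Finset.sum_const, Finset.sum_const, nsmul_eq_mul, nsmul_eq_mul]
    have := Finset.card_filter_add_card_filter_not (s := D) (fun x => Marked L (x, F x))
    have h2 : ((markedSet F D L).card : ℝ) +
      (D.filter fun x => ¬ Marked L (x, F x)).card = D.card := by exact_mod_cast this
    rw [← h2]
    simp [markedSet]
  rw [← hsum, PiLp.inner_apply, Fintype.sum_prod_type]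
  have hx : ∀ x : X, (∑ y : Y, inner ℂ ((uniformState D : QState X Y) (x, y))
      (twoLevelState F D L a b (x, y))) = if x ∈ D then
        (((Real.sqrt D.card)⁻¹ * (if Marked L (x, F x) then a else b) : ℝ) : ℂ) else 0 := by
    intro x
    rw [Finset.sum_eq_single 0]
    · by_cases hx : x ∈ D <;> by_cases hm : Marked L (x, F x) <;>
        simp [uniformState, twoLevelState, hx, hm, mul_comm]
    · intro y _ hy
      simp [uniformState, hy]
    · simp
  simp_rw [hx]
  rw [Finset.sum_ite_mem, Finset.univ_inter, ← Complex.ofReal_sum, ← Finset.mul_sum]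
  congr 1
  ring

/-- Negating the output register before and after a query turns it into the inverse query, so the
first five instructions only flip the sign of `a` and return the output register to `0`. Then comes
the reflection in the uniform state. -/
theorem evolve_groverIteration (hD : D.Nonempty) (a b : ℝ) :
    evolve F (groverIteration D L) (twoLevelState F D L a b) =
      twoLevelState F D L
        (2 * (-(markedSet F D L).card * a + (D.card - (markedSet F D L).card) * b) / D.card + a)
        (2 * (-(markedSet F D L).card * a + (D.card - (markedSet F D L).card) * b) / D.card - b)
      := by
  have hin : negGate (oracle F (negGate (phaseGate L (oracle F (twoLevelState F D L a b))))) =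
      twoLevelState F D L (-a) b := by
    ext ⟨x, y⟩
    rw [negGate_apply, oracle_apply, negGate_apply, phaseGate_apply, oracle_apply]
    have h1 : -(-y - F x) = y + F x := by abel
    rw [h1, add_sub_cancel_right]
    by_cases hx : x ∈ D ∧ y = 0
    · obtain ⟨hx, rfl⟩ := hx
      by_cases hm : Marked L (x, F x) <;> simp [twoLevelState, hx, hm]
    · simp [twoLevelState, hx]
  have hM : (0 : ℝ) < D.card := by exact_mod_cast hD.card_pos
  change diffusionGate D (negGate (oracle F (negGate (phaseGate L (oracle F
    (twoLevelState F D L a b)))))) = _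
  rw [hin, diffusionGate, Submodule.reflection_singleton_apply,
    inner_uniformState_twoLevelState, norm_uniformState D hD]
  have hs : Real.sqrt D.card ≠ 0 := by positivity
  have hss : Real.sqrt D.card * Real.sqrt D.card = D.card := Real.mul_self_sqrt hM.le
  ext ⟨x, y⟩
  by_cases hx : x ∈ D ∧ y = 0
  · obtain ⟨hx, rfl⟩ := hx
    have key : ∀ s c : ℝ, (2 * (s / Real.sqrt D.card * (Real.sqrt D.card)⁻¹) - c) =
        2 * s / D.card - c := by
      intro s c
      have h : ∀ q M : ℝ, q ≠ 0 → q * q = M →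
          2 * (s / q * q⁻¹) - c = 2 * s / M - c := by
        rintro q _ hq rfl
        field_simp
      exact h _ _ hs hss
    by_cases hm : Marked L (x, F x)
    · have := key ((markedSet F D L).card * -a + (D.card - (markedSet F D L).card) * b) (-a)
      simp only [uniformState, twoLevelState, hx, hm, and_self, if_true, PiLp.sub_apply,
        PiLp.smul_apply, smul_eq_mul, nsmul_eq_mul]
      rw [show -((markedSet F D L).card : ℝ) * a = (markedSet F D L).card * -a by ring]
      rw [show ∀ t : ℝ, t + a = t - -a by intro t; ring, ← this]
      push_cast
      simp
    · have := key ((markedSet F D L).card * -a + (D.card - (markedSet F D L).card) * b) b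
      simp only [uniformState, twoLevelState, hx, hm, and_self, if_true, PiLp.sub_apply,
        PiLp.smul_apply, smul_eq_mul, nsmul_eq_mul, if_false]
      rw [show -((markedSet F D L).card : ℝ) * a = (markedSet F D L).card * -a by ring]
      rw [← this]
      push_cast
      simp
  · simp [uniformState, twoLevelState, hx]

/-- The angle of a Grover search with `K` solutions among `M` inputs. -/
def groverAngle (K M : ℕ) : ℝ := Real.arcsin (Real.sqrt (K / M))

theorem sin_groverAngle {K M : ℕ} (h : K ≤ M) :
    Real.sin (groverAngle K M) = Real.sqrt (K / M) := by
  have h1 : Real.sqrt ((K : ℝ) / M) ≤ 1 := by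
    refine Real.sqrt_le_one.2 ?_
    exact div_le_one_of_le₀ (by exact_mod_cast h) (by positivity)
  exact Real.sin_arcsin (by linarith [Real.sqrt_nonneg ((K : ℝ) / M)]) h1

theorem groverAngle_nonneg (K M : ℕ) : 0 ≤ groverAngle K M :=
  Real.arcsin_nonneg.2 (Real.sqrt_nonneg _)

theorem groverAngle_le (K M : ℕ) : groverAngle K M ≤ Real.pi / 2 := Real.arcsin_le_pi_div_two _

theorem sin_sq_groverAngle {K M : ℕ} (h : K ≤ M) :
    Real.sin (groverAngle K M) ^ 2 = K / M := by
  rw [sin_groverAngle h, Real.sq_sqrt (by positivity)]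

theorem cos_groverAngle {K M : ℕ} (h : K ≤ M) (hM : 0 < M) :
    Real.cos (groverAngle K M) = Real.sqrt ((M - K) / M) := by
  have hM' : (0 : ℝ) < M := by exact_mod_cast hM
  have h1 := Real.sin_sq_add_cos_sq (groverAngle K M)
  rw [sin_sq_groverAngle h] at h1
  have h2 : 0 ≤ Real.cos (groverAngle K M) := Real.cos_nonneg_of_neg_pi_div_two_le_of_le
    (by linarith [groverAngle_nonneg K M, Real.pi_pos]) (groverAngle_le K M)
  rw [← Real.sqrt_sq h2, sub_div, div_self hM'.ne']
  congr 1
  linarith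

theorem card_markedSet_le : (markedSet F D L).card ≤ D.card := Finset.card_filter_le _ _

/-- `√K a` and `√(M-K) b` are the coordinates with respect to the normalized superpositions of
solutions and of non-solutions, and one iteration rotates this plane by `2θ`. Keeping the square
roots as factors makes the formulas valid for `K = 0` and `K = M` too, when one of the amplitudes
belongs to no input. -/
theorem exists_evolve_iterations (hD : D.Nonempty) (j : ℕ) :
    ∃ a b : ℝ, evolve F (List.replicate j (groverIteration D L)).flatten
        (uniformState D : QState X Y) = twoLevelState F D L a b ∧
      Real.sqrt (markedSet F D L).card * a =
        Real.sin ((2 * j + 1) * groverAngle (markedSet F D L).card D.card) ∧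
      Real.sqrt (D.card - (markedSet F D L).card) * b =
        Real.cos ((2 * j + 1) * groverAngle (markedSet F D L).card D.card) := by
  have hKM := card_markedSet_le F D L
  have hM : (0 : ℝ) < D.card := by exact_mod_cast hD.card_pos
  set K := (markedSet F D L).card with hK
  set M := D.card with hMd
  set θ := groverAngle K M with hθ
  have hKM' : (K : ℝ) ≤ M := by exact_mod_cast hKM
  have hs : Real.sin θ = Real.sqrt K / Real.sqrt M := by
    rw [hθ, sin_groverAngle hKM, Real.sqrt_div (by positivity)]
  have hc : Real.cos θ = Real.sqrt (M - K) / Real.sqrt M := by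
    rw [hθ, cos_groverAngle hKM hD.card_pos, Real.sqrt_div (by linarith)]
  have h1 : Real.sqrt K * Real.sqrt K = K := Real.mul_self_sqrt (by positivity)
  have h2 : Real.sqrt M * Real.sqrt M = M := Real.mul_self_sqrt (by positivity)
  have h3 : Real.sqrt (M - K) * Real.sqrt (M - K) = M - K := Real.mul_self_sqrt (by linarith)
  have hsM : Real.sqrt M ≠ 0 := by positivity
  -- The rotation by `2θ` with `sin θ = r/q` and `cos θ = p/q`, as an algebraic identity in which
  -- the square roots are just numbers with known squares.
  have step : ∀ r p q K M a b : ℝ, q ≠ 0 → r * r = K → q * q = M → p * p = M - K →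
      r * (2 * (-K * a + (M - K) * b) / M + a) =
        r * a * ((p / q) ^ 2 - (r / q) ^ 2) + p * b * (2 * (r / q) * (p / q)) ∧
      p * (2 * (-K * a + (M - K) * b) / M - b) =
        p * b * ((p / q) ^ 2 - (r / q) ^ 2) - r * a * (2 * (r / q) * (p / q)) := by
    rintro r p q _ _ a b hq rfl rfl h
    rw [← h]
    constructor
    · field_simp
      linear_combination -(r * a) * h
    · field_simp
      linear_combination (p * b) * h
  induction j with
  | zero =>
    refine ⟨_, _, uniformState_eq_twoLevelState F D L, ?_, ?_⟩
    · simp [hs, div_eq_mul_inv, ← hMd]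
    · simp [hc, div_eq_mul_inv, ← hMd]
  | succ j ih =>
    obtain ⟨a, b, h, ha, hb⟩ := ih
    rw [List.replicate_succ', List.flatten_append, evolve_append, h]
    simp only [List.flatten_cons, List.flatten_nil, List.append_nil]
    rw [evolve_groverIteration F D L hD]
    refine ⟨_, _, rfl, ?_, ?_⟩
    all_goals
      rw [← hK, ← hMd, show (2 * ((j + 1 : ℕ) : ℝ) + 1) * θ = (2 * j + 1) * θ + 2 * θ by
        push_cast; ring]
    · rw [Real.sin_add, ← ha, ← hb, Real.sin_two_mul, Real.cos_two_mul', hs, hc]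
      exact (step _ _ _ _ _ a b hsM h1 h2 h3).1
    · rw [Real.cos_add, ← ha, ← hb, Real.sin_two_mul, Real.cos_two_mul', hs, hc]
      exact (step _ _ _ _ _ a b hsM h1 h2 h3).2

theorem evolve_groverCircuit_apply (ψ : QState X Y) (j : ℕ) (x : X) (y : Y) :
    evolve F (groverCircuit D L j) ψ (x, y) =
      evolve F (List.replicate j (groverIteration D L)).flatten ψ (x, y - F x) := by
  unfold groverCircuit
  rw [evolve_append]
  rfl

/-- The distribution of the measured pair after `j` Grover iterations. -/
theorem sum_groverCircuit (hD : D.Nonempty) (hK : 0 < (markedSet F D L).card) (j : ℕ)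
    (h : X × Y → ℝ≥0∞) (c : ℝ≥0∞) :
    (∑ p, ENNReal.ofReal (‖evolve F (groverCircuit D L j) (uniformState D : QState X Y) p‖ ^ 2) *
        if Marked L p then h p else c) =
      ENNReal.ofReal
          (Real.sin ((2 * j + 1) * groverAngle (markedSet F D L).card D.card) ^ 2) *
        ((∑ x ∈ markedSet F D L, h (x, F x)) / (markedSet F D L).card) +
      ENNReal.ofReal
          (Real.cos ((2 * j + 1) * groverAngle (markedSet F D L).card D.card) ^ 2) * c := by
  obtain ⟨a, b, hab, ha, hb⟩ := exists_evolve_iterations F D L hD j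
  have hKM' : ((markedSet F D L).card : ℝ) ≤ D.card := by exact_mod_cast card_markedSet_le F D L
  rw [← ha, ← hb, mul_pow, mul_pow, Real.sq_sqrt (by positivity), Real.sq_sqrt (by linarith),
    Fintype.sum_prod_type]
  have hx : ∀ x : X, (∑ y : Y, ENNReal.ofReal
      (‖evolve F (groverCircuit D L j) (uniformState D : QState X Y) (x, y)‖ ^ 2) *
        if Marked L (x, y) then h (x, y) else c) = if x ∈ D then
        (if Marked L (x, F x) then ENNReal.ofReal (a ^ 2) * h (x, F x)
          else ENNReal.ofReal (b ^ 2) * c) else 0 := by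
    intro x
    -- The iterations leave `0` in the output register, so after the final query only the pairs `(x,
    -- F x)` have amplitude.
    rw [Finset.sum_eq_single (F x)]
    · rw [evolve_groverCircuit_apply, hab, sub_self]
      by_cases hx : x ∈ D <;> by_cases hm : Marked L (x, F x) <;>
        simp [twoLevelState, hx, hm]
    · intro y _ hy
      rw [evolve_groverCircuit_apply, hab]
      simp [twoLevelState, sub_eq_zero, hy]
    · simp
  simp_rw [hx]
  rw [Finset.sum_ite_mem, Finset.univ_inter, Finset.sum_ite, Finset.sum_const]
  have hcard : (D.filter fun x => ¬ Marked L (x, F x)).card =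
      D.card - (markedSet F D L).card := by
    have := Finset.card_filter_add_card_filter_not (s := D) (fun x => Marked L (x, F x))
    unfold markedSet
    omega
  rw [hcard]
  congr 1
  · rw [← Finset.mul_sum, ENNReal.ofReal_mul (by positivity), ENNReal.ofReal_natCast,
      mul_comm ((markedSet F D L).card : ℝ≥0∞), mul_assoc, ENNReal.mul_div_cancel]
    · rfl
    · exact_mod_cast hK.ne'
    · exact ENNReal.natCast_ne_top _
  · rw [ENNReal.ofReal_mul (by linarith), nsmul_eq_mul, ← mul_assoc,
      ← Nat.cast_sub (card_markedSet_le F D L), ENNReal.ofReal_natCast]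

/-- The expectation over a nonempty run of Grover search splits off its first round. -/
theorem expect_groverSearch_succ (hD : D.Nonempty) (hK : 0 < (markedSet F D L).card) (R : ℕ)
    (m : ℝ) (g : Option (X × Y) × ℕ → ℝ≥0∞) :
    (groverSearch D hD L (R + 1) m).expect F g =
      (∑ j : Fin (⌈m⌉₊ - 1 + 1),
        (ENNReal.ofReal
            (Real.sin ((2 * (j : ℕ) + 1) * groverAngle (markedSet F D L).card D.card) ^ 2) *
          ((∑ x ∈ markedSet F D L, g (some (x, F x), 2 * j + 1)) / (markedSet F D L).card) +
        ENNReal.ofReal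
            (Real.cos ((2 * (j : ℕ) + 1) * groverAngle (markedSet F D L).card D.card) ^ 2) *
          (groverSearch D hD L R (min (6 / 5 * m) (Real.sqrt D.card))).expect F
            fun r => g (r.1, r.2 + (2 * j + 1)))) / (⌈m⌉₊ - 1 + 1 : ℕ) := by
  rw [groverSearch, QProg.expect_random]
  congr 1
  refine Finset.sum_congr rfl fun j _ => ?_
  rw [QProg.expect_run]
  refine Eq.trans ?_ (sum_groverCircuit F D L hD hK j (fun p => g (some p, 2 * j + 1)) _)
  refine Finset.sum_congr rfl fun p _ => ?_
  rw [queryCount_groverCircuit]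
  split_ifs
  · rw [QProg.expect_ret]
    simp
  · rfl

theorem sum_div_card_le {ι : Type w} (s : Finset ι) (f : ι → ℝ≥0∞) {c : ℝ≥0∞}
    (h : ∀ i ∈ s, f i ≤ c) : (∑ i ∈ s, f i) / s.card ≤ c := by
  refine ENNReal.div_le_of_le_mul ?_
  rw [mul_comm, ← nsmul_eq_mul]
  exact Finset.sum_le_card_nsmul _ _ _ h

theorem ofReal_sin_sq_add_cos_sq (t : ℝ) :
    ENNReal.ofReal (Real.sin t ^ 2) + ENNReal.ofReal (Real.cos t ^ 2) = 1 := by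
  rw [← ENNReal.ofReal_add (by positivity) (by positivity), Real.sin_sq_add_cos_sq]
  simp

/-- Each solution is found with probability at most one over the number of solutions. -/
theorem expect_groverSearch_le (hD : D.Nonempty) (hK : 0 < (markedSet F D L).card) (R : ℕ)
    (m : ℝ) (h : X × Y → ℝ≥0∞) :
    (groverSearch D hD L R m).expect F (fun r => r.1.elim 0 h) ≤
      (∑ x ∈ markedSet F D L, h (x, F x)) / (markedSet F D L).card := by
  induction R generalizing m with
  | zero => simp [groverSearch, QProg.expect_ret]
  | succ R ih =>
    rw [expect_groverSearch_succ F D L hD hK]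
    rw [show ((⌈m⌉₊ - 1 + 1 : ℕ) : ℝ≥0∞) = (Finset.univ : Finset (Fin (⌈m⌉₊ - 1 + 1))).card by
      rw [Finset.card_univ, Fintype.card_fin]]
    refine sum_div_card_le _ _ fun j _ => ?_
    · calc _ ≤ ENNReal.ofReal
            (Real.sin ((2 * (j : ℕ) + 1) * groverAngle (markedSet F D L).card D.card) ^ 2) *
          ((∑ x ∈ markedSet F D L, h (x, F x)) / (markedSet F D L).card) +
        ENNReal.ofReal
            (Real.cos ((2 * (j : ℕ) + 1) * groverAngle (markedSet F D L).card D.card) ^ 2) *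
          ((∑ x ∈ markedSet F D L, h (x, F x)) / (markedSet F D L).card) := by
            gcongr
            · simp
            · exact ih _
        _ = _ := by rw [← add_mul, ofReal_sin_sq_add_cos_sq, one_mul]

/-- The sum telescopes: `2 sin α cos((2j+1)α) = sin(2(j+1)α) - sin(2jα)`. -/
theorem two_mul_sin_mul_sum_cos (m : ℕ) (α : ℝ) :
    2 * Real.sin α * ∑ j ∈ Finset.range m, Real.cos ((2 * j + 1) * α) = Real.sin (2 * m * α) := by
  induction m with
  | zero => simp
  | succ m ih =>
    rw [Finset.sum_range_succ, mul_add, ih]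
    have h1 : (2 * ((m + 1 : ℕ) : ℝ) * α) = (2 * m + 1) * α + α := by push_cast; ring
    have h2 : (2 * (m : ℝ) * α) = (2 * m + 1) * α - α := by ring
    rw [h1, h2, Real.sin_add, Real.sin_sub]
    ring

theorem sum_cos_le_of_one_le_mul_sin {m : ℕ} {α : ℝ} (hs : 0 < Real.sin α)
    (h : 1 ≤ m * Real.sin α) :
    ∑ j ∈ Finset.range m, Real.cos ((2 * j + 1) * α) ≤ m / 2 := by
  have h1 := two_mul_sin_mul_sum_cos m α
  have h2 := Real.sin_le_one (2 * m * α)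
  have h3 : 2 * Real.sin α * ∑ j ∈ Finset.range m, Real.cos ((2 * j + 1) * α) ≤
      2 * Real.sin α * (m / 2) := by rw [h1]; nlinarith
  exact le_of_mul_le_mul_left h3 (by positivity)

/-- With `γ = π - α` every term changes sign, as `2j+1` is odd. If `m sin α < 1`, Jordan's
inequality gives `2mγ ≤ π`, so the sum for `γ` is nonnegative and the one for `α` at most `0`. Hence
an obtuse angle needs no lower bound on `m`. -/
theorem sum_cos_le_of_pi_div_two_le {m : ℕ} {α : ℝ} (h₁ : Real.pi / 2 ≤ α) (h₂ : α ≤ Real.pi) :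
    ∑ j ∈ Finset.range m, Real.cos ((2 * j + 1) * α) ≤ m / 2 := by
  set γ := Real.pi - α with hγ
  have hneg : ∀ j : ℕ, Real.cos ((2 * j + 1) * α) = -Real.cos ((2 * j + 1) * γ) := by
    intro j
    rw [show (2 * (j : ℝ) + 1) * α = Real.pi - (2 * j + 1) * γ + (j : ℤ) * (2 * Real.pi) by
      rw [hγ]; push_cast; ring, Real.cos_add_int_mul_two_pi, Real.cos_pi_sub]
  have hsin : Real.sin α = Real.sin γ := by rw [hγ, Real.sin_pi_sub]
  rcases eq_or_lt_of_le h₂ with h | h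
  · have : γ = 0 := by rw [hγ, h, sub_self]
    simp_rw [hneg, this]
    simp
    have : (0 : ℝ) ≤ m := by positivity
    linarith
  · have hs : 0 < Real.sin α := Real.sin_pos_of_pos_of_lt_pi (by linarith [Real.pi_pos]) h
    rcases le_or_gt 1 (m * Real.sin α) with h1 | h1
    · exact sum_cos_le_of_one_le_mul_sin hs h1
    · have h2 : 2 / Real.pi * γ ≤ Real.sin γ := Real.mul_le_sin (by linarith) (by linarith)
      have h3 : 2 * γ ≤ Real.pi * Real.sin γ := by
        have := mul_le_mul_of_nonneg_left h2 Real.pi_pos.le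
        rwa [← mul_assoc, mul_div_cancel₀ _ Real.pi_ne_zero] at this
      have h4 : 2 * m * γ ≤ Real.pi := by
        rw [hsin] at h1
        have : (0 : ℝ) ≤ m := by positivity
        nlinarith [Real.pi_pos]
      have hγ0 : 0 < γ := by linarith
      have h5 : 0 ≤ Real.sin (2 * m * γ) := Real.sin_nonneg_of_nonneg_of_le_pi (by positivity) h4
      rw [← two_mul_sin_mul_sum_cos m γ, ← hsin] at h5
      have h6 := nonneg_of_mul_nonneg_right h5 (by positivity)
      simp_rw [hneg]
      rw [Finset.sum_neg_distrib]
      have : (0 : ℝ) ≤ m := by positivity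
      linarith

/-- A round of Grover search that draws `j` from at least `√(M / K)` integers fails with
probability at most `3 / 4`. -/
theorem sum_cos_sq_le {K M m : ℕ} (hK : 0 < K) (hKM : K ≤ M)
    (hm : Real.sqrt (M / K) ≤ m) :
    ∑ j ∈ Finset.range m, Real.cos ((2 * j + 1) * groverAngle K M) ^ 2 ≤ 3 / 4 * m := by
  set θ := groverAngle K M with hθ
  have hcos : ∑ j ∈ Finset.range m, Real.cos ((2 * j + 1) * (2 * θ)) ≤ m / 2 := by
    -- For `θ ≥ π/4` the angle `2θ` is obtuse and `sin 2θ` may be tiny. Otherwise `cos θ ≥ 1/2`, so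
    -- `sin 2θ ≥ sin θ = √(K/M)` and the assumption on `m` gives `m sin 2θ ≥ 1`.
    rcases le_or_gt (Real.pi / 4) θ with h | h
    · exact sum_cos_le_of_pi_div_two_le (by linarith) (by linarith [groverAngle_le K M])
    · have hc : 1 / 2 ≤ Real.cos θ := by
        rw [← Real.cos_pi_div_three]
        exact Real.cos_le_cos_of_nonneg_of_le_pi (groverAngle_nonneg K M)
          (by linarith [Real.pi_pos]) (by linarith [Real.pi_pos])
      have hs : Real.sin θ = Real.sqrt (K / M) := sin_groverAngle hKM
      have hM' : (0 : ℝ) < M := by exact_mod_cast hK.trans_le hKM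
      have hK' : (0 : ℝ) < K := by exact_mod_cast hK
      have hs0 : 0 < Real.sin θ := by rw [hs]; positivity
      have h1 : 1 ≤ m * Real.sin θ := by
        calc 1 = Real.sqrt (M / K) * Real.sin θ := by
              rw [hs, ← Real.sqrt_mul (by positivity)]
              field_simp
              simp
          _ ≤ _ := by gcongr
      have h2 : Real.sin θ ≤ Real.sin (2 * θ) := by
        rw [Real.sin_two_mul]
        nlinarith
      refine sum_cos_le_of_one_le_mul_sin (hs0.trans_le h2) (h1.trans ?_)
      gcongr
  have h3 : ∀ j : ℕ, Real.cos ((2 * j + 1) * θ) ^ 2 =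
      1 / 2 + 1 / 2 * Real.cos ((2 * j + 1) * (2 * θ)) := by
    intro j
    rw [Real.cos_sq]
    ring_nf
  simp_rw [h3]
  rw [Finset.sum_add_distrib, ← Finset.mul_sum]
  simp
  linarith

/-- A round costs `2j + 1 ≤ 3m` queries, because `j < m` and `m ≥ 1`. The remaining rounds, of
expected cost at most `V` whatever `j` was, are needed only on failure, which has probability at
most `q` on average over `j`. -/
theorem expect_groverSearch_queries_succ (hD : D.Nonempty) (hK : 0 < (markedSet F D L).card)
    (R : ℕ) {m : ℝ} (hm : 1 ≤ m) {q V : ℝ} (hq : 0 ≤ q) (hV : 0 ≤ V)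
    (hrec : (groverSearch D hD L R (min (6 / 5 * m) (Real.sqrt D.card))).expect F
      (fun r => (r.2 : ℝ≥0∞)) ≤ ENNReal.ofReal V)
    (hcos : ∑ j ∈ Finset.range ⌈m⌉₊,
      Real.cos ((2 * j + 1) * groverAngle (markedSet F D L).card D.card) ^ 2 ≤ q * ⌈m⌉₊) :
    (groverSearch D hD L (R + 1) m).expect F (fun r => (r.2 : ℝ≥0∞)) ≤
      ENNReal.ofReal (3 * m + q * V) := by
  have hpos : 0 < ⌈m⌉₊ := Nat.ceil_pos.2 (by linarith)
  have hn : ⌈m⌉₊ - 1 + 1 = ⌈m⌉₊ := by omega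
  rw [expect_groverSearch_succ F D L hD hK]
  refine ENNReal.div_le_of_le_mul ?_
  calc _ ≤ ∑ j : Fin (⌈m⌉₊ - 1 + 1), ENNReal.ofReal (3 * m +
          Real.cos ((2 * (j : ℕ) + 1) * groverAngle (markedSet F D L).card D.card) ^ 2 * V) := by
        refine Finset.sum_le_sum fun j _ => ?_
        have hj : (j : ℝ) < m := by
          have h1 : (j : ℕ) < ⌈m⌉₊ := by omega
          exact Nat.lt_ceil.1 h1
        have hc : ((2 * (j : ℕ) + 1 : ℕ) : ℝ≥0∞) ≤ ENNReal.ofReal (3 * m) := by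
          rw [← ENNReal.ofReal_natCast]
          refine ENNReal.ofReal_le_ofReal ?_
          push_cast
          linarith
        set t := (2 * ((j : ℕ) : ℝ) + 1) * groverAngle (markedSet F D L).card D.card
        rw [ENNReal.ofReal_add (by positivity) (by positivity),
          ENNReal.ofReal_mul (p := Real.cos t ^ 2) (by positivity)]
        calc _ ≤ ENNReal.ofReal (Real.sin t ^ 2) * ENNReal.ofReal (3 * m) +
              ENNReal.ofReal (Real.cos t ^ 2) * (ENNReal.ofReal V + ENNReal.ofReal (3 * m)) := by
              gcongr
              · exact sum_div_card_le _ _ fun x _ => hc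
              · refine le_trans (le_of_eq ?_) (add_le_add hrec hc)
                simp only [Nat.cast_add]
                rw [QProg.expect_add, QProg.expect_const]
          _ = (ENNReal.ofReal (Real.sin t ^ 2) + ENNReal.ofReal (Real.cos t ^ 2)) *
              ENNReal.ofReal (3 * m) + ENNReal.ofReal (Real.cos t ^ 2) * ENNReal.ofReal V := by
              ring
          _ = _ := by rw [ofReal_sin_sq_add_cos_sq, one_mul]
    _ = ENNReal.ofReal (∑ j : Fin (⌈m⌉₊ - 1 + 1), (3 * m +
          Real.cos ((2 * (j : ℕ) + 1) * groverAngle (markedSet F D L).card D.card) ^ 2 * V)) :=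
        (ENNReal.ofReal_sum_of_nonneg fun j _ => by positivity).symm
    _ ≤ _ := by
        rw [hn, ← ENNReal.ofReal_natCast, ← ENNReal.ofReal_mul (by positivity),
          Fin.sum_univ_eq_sum_range (fun j : ℕ => 3 * m +
          Real.cos ((2 * (j : ℕ) + 1) * groverAngle (markedSet F D L).card D.card) ^ 2 * V)]
        refine ENNReal.ofReal_le_ofReal ?_
        have h := mul_le_mul_of_nonneg_right hcos hV
        rw [Finset.sum_mul] at h
        rw [Finset.sum_add_distrib, Finset.sum_const, Finset.card_range, nsmul_eq_mul]
        linarith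

/-- Let `m₀ = √(M/K)`. For `m ≥ m₀` a round fails with probability at most `3/4` while `m` grows by
at most `6/5`; as `3/4 · 6/5 < 1` the costs form a convergent series, and `3m + (3/4) · 30 · (6/5)m
= 30m`. Below `m₀` every round is assumed to fail: `3m - 15 · (6/5)m = -15m` there, and at the
crossing `3m + 30 · (6/5)m = 39m ≤ 54m₀ - 15m`. -/
theorem expect_groverSearch_queries_aux (hD : D.Nonempty) (hK : 0 < (markedSet F D L).card)
    (R : ℕ) {m : ℝ} (hm : 1 ≤ m) (hm' : m ≤ Real.sqrt D.card) :
    (groverSearch D hD L R m).expect F (fun r => (r.2 : ℝ≥0∞)) ≤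
      ENNReal.ofReal (if Real.sqrt (D.card / (markedSet F D L).card) ≤ m then 30 * m else
        54 * Real.sqrt (D.card / (markedSet F D L).card) - 15 * m) := by
  induction R generalizing m with
  | zero => simp [groverSearch, QProg.expect_ret]
  | succ R ih =>
    have hK' : (1 : ℝ) ≤ (markedSet F D L).card := by exact_mod_cast hK
    have hsq : Real.sqrt (D.card / (markedSet F D L).card) ≤ Real.sqrt D.card :=
      Real.sqrt_le_sqrt (div_le_self (by positivity) hK')
    have hm2 : 1 ≤ min (6 / 5 * m) (Real.sqrt D.card) := le_min (by linarith) (by linarith)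
    have ih' := ih hm2 (min_le_right _ _)
    have hmle : m ≤ min (6 / 5 * m) (Real.sqrt D.card) := le_min (by linarith) hm'
    have hle : min (6 / 5 * m) (Real.sqrt D.card) ≤ 6 / 5 * m := min_le_left _ _
    by_cases h : Real.sqrt (D.card / (markedSet F D L).card) ≤ m
    · rw [if_pos (h.trans hmle)] at ih'
      rw [if_pos h]
      refine (expect_groverSearch_queries_succ F D L hD hK R hm (q := 3 / 4) (by norm_num)
        (by linarith) ih' (sum_cos_sq_le hK (card_markedSet_le F D L)
          (h.trans (Nat.le_ceil m)))).trans (ENNReal.ofReal_le_ofReal ?_)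
      linarith
    · rw [if_neg h]
      have hone : ∑ j ∈ Finset.range ⌈m⌉₊,
          Real.cos ((2 * j + 1) * groverAngle (markedSet F D L).card D.card) ^ 2 ≤
            1 * (⌈m⌉₊ : ℝ) := by
        calc _ ≤ ∑ j ∈ Finset.range ⌈m⌉₊, (1 : ℝ) :=
              Finset.sum_le_sum fun j _ => Real.cos_sq_le_one _
          _ = _ := by simp
      rw [not_le] at h
      by_cases h2 : Real.sqrt (D.card / (markedSet F D L).card) ≤
          min (6 / 5 * m) (Real.sqrt D.card)
      · rw [if_pos h2] at ih'
        refine (expect_groverSearch_queries_succ F D L hD hK R hm zero_le_one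
          (by linarith) ih' hone).trans (ENNReal.ofReal_le_ofReal ?_)
        linarith
      · rw [if_neg h2] at ih'
        rw [not_le] at h2
        -- The cap `√M` is not active below `√(M/K)`, since `K ≥ 1`.
        have heq : min (6 / 5 * m) (Real.sqrt D.card) = 6 / 5 * m := by
          refine min_eq_left ?_
          by_contra hlt
          rw [not_le] at hlt
          rw [min_eq_right hlt.le] at h2
          linarith
        refine (expect_groverSearch_queries_succ F D L hD hK R hm zero_le_one
          (by linarith) ih' hone).trans (ENNReal.ofReal_le_ofReal ?_)
        rw [heq]
        linarith

/-- Grover search makes an expected number of `O(√(M / K))` queries. -/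
theorem expect_groverSearch_queries (hD : D.Nonempty) (hK : 0 < (markedSet F D L).card)
    (R : ℕ) : (groverSearch D hD L R 1).expect F (fun r => (r.2 : ℝ≥0∞)) ≤
      ENNReal.ofReal (54 * Real.sqrt (D.card / (markedSet F D L).card)) := by
  have hM : (1 : ℝ) ≤ D.card := by exact_mod_cast hD.card_pos
  refine (expect_groverSearch_queries_aux F D L hD hK R le_rfl (Real.one_le_sqrt.2 hM)).trans
    (ENNReal.ofReal_le_ofReal ?_)
  split_ifs with h
  · have : 1 ≤ Real.sqrt (D.card / (markedSet F D L).card) := by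
      rw [Real.one_le_sqrt, one_le_div (by exact_mod_cast hK)]
      exact_mod_cast card_markedSet_le F D L
    linarith
  · linarith

theorem groverSearch_support (hD : D.Nonempty) (R : ℕ) (m : ℝ) :
    ∀ r ∈ ((groverSearch D hD L R m).dist F).support,
      (r.1 = none → R ≤ r.2) ∧
      ∀ p, r.1 = some p → p.1 ∈ D ∧ p.2 = F p.1 ∧ Marked L p := by
  induction R generalizing m with
  | zero => simp [groverSearch, QProg.dist]
  | succ R ih =>
    intro r hr
    rw [groverSearch] at hr
    simp only [QProg.dist, PMF.mem_support_bind_iff, PMF.mem_support_map_iff] at hr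
    obtain ⟨j, -, p, hp, r', hr, rfl⟩ := hr
    by_cases hM : Marked L p
    · rw [if_pos hM] at hr
      simp only [QProg.dist, PMF.support_pure, Set.mem_singleton_iff] at hr
      subst hr
      refine ⟨by simp, fun q hq => ?_⟩
      simp only [Option.some.injEq] at hq
      subst hq
      obtain ⟨x, y⟩ := p
      obtain ⟨a, b, hab, -⟩ := exists_evolve_iterations F D L hD j
      have h0 : evolve F (groverCircuit D L j) (uniformState D : QState X Y) (x, y) ≠ 0 := by
        intro h0
        rw [PMF.mem_support_iff] at hp
        exact hp (by simp [measure, h0])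
      rw [evolve_groverCircuit_apply, hab] at h0
      by_cases hx : x ∈ D ∧ y - F x = 0
      · exact ⟨hx.1, sub_eq_zero.1 hx.2, hM⟩
      · simp [twoLevelState, hx] at h0
    · rw [if_neg hM] at hr
      refine ⟨fun h => ?_, (ih _ r' hr).2⟩
      have := (ih _ r' hr).1 h
      rw [queryCount_groverCircuit]
      dsimp only
      omega

/-- A search with `R` rounds fails with probability at most `O(√(M / K)) / R`. -/
theorem expect_groverSearch_none (hD : D.Nonempty) (hK : 0 < (markedSet F D L).card)
    {R : ℕ} (hR : 0 < R) :
    (groverSearch D hD L R 1).expect F (fun r => if r.1 = none then 1 else 0) ≤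
      ENNReal.ofReal (54 * Real.sqrt (D.card / (markedSet F D L).card) / R) := by
  have hR' : (0 : ℝ) < R := by exact_mod_cast hR
  rw [ENNReal.ofReal_div_of_pos hR', ENNReal.ofReal_natCast, ENNReal.le_div_iff_mul_le
    (Or.inl (by exact_mod_cast hR.ne')) (Or.inl (ENNReal.natCast_ne_top _)), mul_comm,
    ← QProg.expect_const_mul]
  -- Markov's inequality: an unsuccessful search has gone through all `R` rounds, with at least one
  -- query in each.
  refine (QProg.expect_mono F _ fun r hr => ?_).trans (expect_groverSearch_queries F D L hD hK R)
  split_ifs with h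
  · rw [mul_one]
    exact_mod_cast (groverSearch_support F D L hD R 1 r hr).1 h
  · simp

end Grover

/-! ### Partitions of the fibres into blocks -/

section Blocks

set_option linter.unusedSectionVars false

theorem exists_bijOn_range {X : Type u} [DecidableEq X] (s : Finset X) :
    ∃ f : X → ℕ, Set.InjOn f s ∧ s.image f = Finset.range s.card := by
  refine ⟨fun x => if h : x ∈ s then s.equivFin ⟨x, h⟩ else 0, ?_, ?_⟩
  · intro x hx y hy h
    rw [Finset.mem_coe] at hx hy
    simp only [hx, hy, dif_pos] at h
    have := s.equivFin.injective (Fin.ext h)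
    simpa using this
  · ext i
    simp only [Finset.mem_image, Finset.mem_range]
    constructor
    · rintro ⟨x, hx, rfl⟩
      simp [hx]
    · intro hi
      refine ⟨s.equivFin.symm ⟨i, hi⟩, (s.equivFin.symm ⟨i, hi⟩).2, ?_⟩
      simp

variable {X : Type u} {Y : Type v} [Fintype X] [Fintype Y] [DecidableEq X] [DecidableEq Y]

/-- A partition of the fibres of `F` on `D` into blocks of at most `k` inputs, such that in each
fibre fewer than `k` inputs are in blocks of fewer than `k` inputs. -/
structure BlockPartition (F : X → Y) (D : Finset X) (k : ℕ) where
  /-- The label of the block of an input. -/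
  label : X → Y × ℕ
  map_eq_of_label_eq : ∀ x x', label x = label x' → F x = F x'
  card_block_le : ∀ b, (D.filter fun x => label x = b).card ≤ k
  card_not_full_lt : ∀ y, (D.filter fun x => F x = y ∧
    (D.filter fun x' => label x' = label x).card ≠ k).card < k

/-- Number the inputs of each fibre consecutively from `0` and let `i / k` be the index of the block
of input number `i`. Only the last block of a fibre of `n` inputs can be incomplete, and then it has
`n % k` inputs. -/
theorem nonempty_blockPartition (F : X → Y) (D : Finset X) {k : ℕ} (hk : 0 < k) :
    Nonempty (BlockPartition F D k) := by
  choose f hinj himg using fun y : Y => exists_bijOn_range (D.filter fun x => F x = y)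
  have hblock : ∀ y q, (D.filter fun x => (F x, f (F x) x / k) = (y, q)).card =
      ((Finset.range (D.filter fun x => F x = y).card).filter fun i => i / k = q).card := by
    intro y q
    rw [← himg y, Finset.filter_image, Finset.card_image_of_injOn]
    · rw [Finset.filter_filter]
      congr 1
      ext x
      simp only [Finset.mem_filter, Prod.mk.injEq]
      constructor
      · rintro ⟨h, rfl, h'⟩
        exact ⟨h, rfl, h'⟩
      · rintro ⟨h, rfl, h'⟩
        exact ⟨h, rfl, h'⟩
    · exact (hinj y).mono fun x hx => by
        simp only [Finset.coe_filter, Set.mem_ofPred_eq] at hx ⊢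
        exact Finset.mem_filter.1 hx.1
  have hsub : ∀ n q, ((Finset.range n).filter fun i => i / k = q) =
      (Finset.Ico (k * q) (k * q + k)).filter fun i => i < n := by
    intro n q
    ext i
    simp only [Finset.mem_filter, Finset.mem_range, Finset.mem_Ico]
    rw [Nat.div_eq_iff hk]
    constructor
    · rintro ⟨h1, h2, h3⟩
      exact ⟨⟨by rw [mul_comm]; exact h2, by rw [mul_comm]; omega⟩, h1⟩
    · rintro ⟨⟨h2, h3⟩, h1⟩
      rw [mul_comm] at h2 h3
      exact ⟨h1, h2, by omega⟩
  refine ⟨⟨fun x => (F x, f (F x) x / k), fun x x' h => (Prod.mk.inj h).1, ?_, ?_⟩⟩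
  · rintro ⟨y, q⟩
    rw [hblock, hsub]
    exact (Finset.card_filter_le _ _).trans (by simp)
  · intro y
    set n := (D.filter fun x => F x = y).card with hn
    -- An input in an incomplete block has a number of at least `k * (n / k)`.
    have hle : (D.filter fun x => F x = y ∧
        (D.filter fun x' => (F x', f (F x') x' / k) = (F x, f (F x) x / k)).card ≠ k).card ≤
        (Finset.Ico (k * (n / k)) n).card := by
      refine Finset.card_le_card_of_injOn (f y) ?_ ?_
      · intro x hx
        simp only [Finset.coe_filter, Set.mem_ofPred_eq] at hx
        obtain ⟨hxD, rfl, hc⟩ := hx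
        have hmem : f (F x) x ∈ Finset.range n := by
          rw [hn, ← himg]
          exact Finset.mem_image_of_mem _ (by simp [hxD])
        rw [Finset.mem_range] at hmem
        rw [Finset.coe_Ico, Set.mem_Ico]
        refine ⟨?_, hmem⟩
        by_contra hlt
        rw [not_le] at hlt
        apply hc
        rw [hblock, hsub, ← hn, Finset.filter_true_of_mem]
        · simp
        · intro i hi
          rw [Finset.mem_Ico] at hi
          have h1 : f (F x) x / k < n / k := by
            rw [Nat.div_lt_iff_lt_mul hk, mul_comm]; exact hlt
          have h2 : k * (f (F x) x / k + 1) ≤ k * (n / k) := Nat.mul_le_mul_left _ h1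
          have h3 := Nat.mul_div_le n k
          rw [mul_add] at h2
          omega
      · refine (hinj y).mono fun x hx => ?_
        simp only [Finset.coe_filter, Set.mem_ofPred_eq] at hx ⊢
        exact ⟨hx.1, hx.2.1⟩
    refine hle.trans_lt ?_
    rw [Nat.card_Ico]
    have := Nat.div_add_mod n k
    have := Nat.mod_lt n hk
    omega

/-! ### Full blocks, good databases and the number of solutions -/

namespace BlockPartition

variable {F : X → Y} {D : Finset X} {k : ℕ} (P : BlockPartition F D k)

/-- The block with label `b`. -/
def block (b : Y × ℕ) : Finset X := D.filter fun x => P.label x = b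

/-- The inputs in blocks of `k` inputs. -/
def full : Finset X := D.filter fun x => (P.block (P.label x)).card = k

/-- Each of the `N` fibres loses at most `k - 1` inputs to an incomplete block, which leaves `kN -
(k-1)N = N`. -/
theorem card_le_card_full (N : ℕ) (hN : N = Fintype.card Y) (hD : D.card = k * N) (hk : 0 < k) :
    N ≤ P.full.card := by
  have h1 := Finset.card_filter_add_card_filter_not (s := D)
    (fun x => (P.block (P.label x)).card = k)
  have h2 : (D.filter fun x => ¬ (P.block (P.label x)).card = k).card ≤ N * (k - 1) := by
    rw [Finset.card_eq_sum_card_fiberwise (f := F) (t := Finset.univ) (by simp)]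
    refine (Finset.sum_le_card_nsmul _ _ (k - 1) fun y _ => ?_).trans_eq ?_
    · have := P.card_not_full_lt y
      have h3 : ((D.filter fun x => ¬ (P.block (P.label x)).card = k).filter
          fun x => F x = y) = (D.filter fun x => F x = y ∧
          (D.filter fun x' => P.label x' = P.label x).card ≠ k) := by
        ext x
        simp only [Finset.mem_filter]
        unfold block
        tauto
      rw [h3]
      omega
    · rw [Finset.card_univ, hN, smul_eq_mul]
  have h3 : N * (k - 1) + N = k * N := by
    obtain ⟨k, rfl⟩ := Nat.exists_eq_succ_of_ne_zero hk.ne'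
    simp
    ring
  unfold full
  omega

/-- This is the birthday bound for blocks: a uniform draw from `W` falls into a block that was hit
before with probability at most `|xs| k / |W|`. -/
theorem card_label_mem_le {W : Finset X} (hW : W ⊆ D) (xs : List X) :
    (W.filter fun x => P.label x ∈ xs.map P.label).card ≤ xs.length * k := by
  have hsub : (W.filter fun x => P.label x ∈ xs.map P.label) ⊆
      (xs.map P.label).toFinset.biUnion P.block := by
    intro x hx
    rw [Finset.mem_filter] at hx
    rw [Finset.mem_biUnion]
    exact ⟨P.label x, List.mem_toFinset.2 hx.2, by simp [block, hW hx.1]⟩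
  refine (Finset.card_le_card hsub).trans ((Finset.card_biUnion_le_card_mul _ _ k
    fun b _ => P.card_block_le b).trans ?_)
  gcongr
  exact (List.toFinset_card_le _).trans_eq (List.length_map _)

theorem card_block_inter_le_one {xs : List X} (hxs : (xs.map P.label).Nodup) (b : Y × ℕ) :
    ((P.block b).filter fun x => x ∈ xs).card ≤ 1 := by
  rw [Finset.card_le_one]
  intro x hx x' hx'
  simp only [block, Finset.mem_filter] at hx hx'
  exact List.inj_on_of_nodup_map hxs hx.2 hx'.2 (hx.1.2.trans hx'.1.2.symm)

/-- A database that suits the next stage of the algorithm: it occupies at most `i` inputs of each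
block, and many inputs in blocks of `k` inputs have an image in the database. -/
structure GoodDatabase (i t : ℕ) (c : ℝ) (L : Database X Y) : Prop where
  length_le : L.length ≤ t
  card_occupied_le : ∀ b, ((P.block b).filter fun x => ∃ e ∈ L, x ∈ e.1).card ≤ i
  le_card_full : c * t ≤ (P.full.filter fun x => ∃ e ∈ L, e.2 = F x).card

/-- Each new entry consists of one drawn input and of inputs already occupied in `L`. The drawn
inputs lie in distinct blocks, so a block gains at most one occupied input, and those in full blocks
themselves witness the lower bound. Sampling is the case `L = []`, `i = 0`. -/
theorem goodDatabase_of_inputs {i t : ℕ} {c : ℝ} {L : Database X Y}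
    (hL : ∀ b, ((P.block b).filter fun x => ∃ e ∈ L, x ∈ e.1).card ≤ i)
    (f : X → Finset X × Y) {xs : List X}
    (hf₁ : ∀ x ∈ xs, ∀ x' ∈ (f x).1, x' = x ∨ ∃ e ∈ L, x' ∈ e.1)
    (hf₂ : ∀ x ∈ xs, (f x).2 = F x) (hlen : xs.length = t) (hxs : (xs.map P.label).Nodup)
    (hc : c * t ≤ xs.countP (· ∈ P.full)) :
    P.GoodDatabase (i + 1) t c (xs.map f) := by
  refine ⟨by simp [hlen], fun b => ?_, hc.trans ?_⟩
  · have hsub : ((P.block b).filter fun x => ∃ e ∈ xs.map f, x ∈ e.1) ⊆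
        ((P.block b).filter fun x => ∃ e ∈ L, x ∈ e.1) ∪ (P.block b).filter fun x => x ∈ xs := by
      intro x hx
      simp only [Finset.mem_filter, List.mem_map, Finset.mem_union] at hx ⊢
      obtain ⟨hb, e, ⟨x', hx', rfl⟩, hxe⟩ := hx
      rcases hf₁ x' hx' x hxe with rfl | h
      · exact Or.inr ⟨hb, hx'⟩
      · exact Or.inl ⟨hb, h⟩
    exact (Finset.card_le_card hsub).trans ((Finset.card_union_le _ _).trans
      (add_le_add (hL b) (P.card_block_inter_le_one hxs b)))
  · have hnd : xs.Nodup := hxs.of_map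
    rw [List.countP_eq_length_filter, ← List.toFinset_card_of_nodup (hnd.filter _)]
    refine Nat.cast_le.2 (Finset.card_le_card fun x hx => ?_)
    simp only [List.mem_toFinset, List.mem_filter, decide_eq_true_eq] at hx
    rw [Finset.mem_filter]
    exact ⟨hx.2, f x, List.mem_map_of_mem hx.1, hf₂ x hx.1⟩

namespace GoodDatabase

variable {P} {i t : ℕ} {c : ℝ} {L : Database X Y} (h : P.GoodDatabase i t c L)

include h

/-- A full block whose image occurs in `L` has `k > i` inputs, of which at most `i` are occupied, so
it contains a solution. Such a block has only `k` inputs. -/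
theorem card_full_le (hik : i < k) :
    (P.full.filter fun x => ∃ e ∈ L, e.2 = F x).card ≤
      k * ((markedSet F D L).filter fun x => x ∈ P.full).card := by
  set T := P.full.filter fun x => ∃ e ∈ L, e.2 = F x
  set W := (markedSet F D L).filter fun x => x ∈ P.full
  have h1 : T.card ≤ k * (T.image P.label).card := by
    refine Finset.card_le_mul_card_image T k fun b _ => ?_
    refine (Finset.card_le_card fun x hx => ?_).trans (P.card_block_le b)
    simp only [T, full, Finset.mem_filter] at hx ⊢
    exact ⟨hx.1.1.1, hx.2⟩
  have h2 : T.image P.label ⊆ W.image P.label := by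
    intro b hb
    rw [Finset.mem_image] at hb ⊢
    obtain ⟨x, hx, rfl⟩ := hb
    simp only [T, full, Finset.mem_filter] at hx
    obtain ⟨⟨hxD, hxk⟩, e, heL, hex⟩ := hx
    have h3 := Finset.card_filter_add_card_filter_not (s := P.block (P.label x))
      (fun x => ∃ e ∈ L, x ∈ e.1)
    have h4 := h.card_occupied_le (P.label x)
    obtain ⟨x', hx'⟩ : ((P.block (P.label x)).filter fun x => ¬ ∃ e ∈ L, x ∈ e.1).Nonempty := by
      rw [← Finset.card_pos]
      omega
    simp only [Finset.mem_filter, block] at hx'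
    obtain ⟨⟨hx'D, hlab⟩, hocc⟩ := hx'
    refine ⟨x', ?_, hlab⟩
    simp only [W, markedSet, full, Finset.mem_filter, hlab]
    refine ⟨⟨hx'D, ?_, e, heL, ?_⟩, hx'D, hxk⟩
    · intro e he hx'e
      exact hocc ⟨e, he, hx'e⟩
    · exact hex.trans (P.map_eq_of_label_eq _ _ hlab.symm)
  calc T.card ≤ k * (T.image P.label).card := h1
    _ ≤ k * W.card := by
      gcongr
      exact (Finset.card_le_card h2).trans Finset.card_image_le

/-- Solutions outside full blocks are few: fewer than `k` for each of the at most `t` images in `L`.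
However large a fibre is, the excess is made of full blocks. -/
theorem card_markedSet_le :
    (markedSet F D L).card ≤
      (P.full.filter fun x => ∃ e ∈ L, e.2 = F x).card + t * (k - 1) := by
  have hsub : markedSet F D L ⊆ (P.full.filter fun x => ∃ e ∈ L, e.2 = F x) ∪
      (L.map Prod.snd).toFinset.biUnion fun y => D.filter fun x => F x = y ∧
        (D.filter fun x' => P.label x' = P.label x).card ≠ k := by
    intro x hx
    rw [markedSet, Finset.mem_filter] at hx
    obtain ⟨hxD, -, e, he, hex⟩ := hx
    change e.2 = F x at hex
    rw [Finset.mem_union]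
    by_cases hf : x ∈ P.full
    · exact Or.inl (Finset.mem_filter.2 ⟨hf, e, he, hex⟩)
    · refine Or.inr (Finset.mem_biUnion.2 ⟨F x, ?_, ?_⟩)
      · rw [List.mem_toFinset, ← hex]
        exact List.mem_map_of_mem he
      · rw [full, Finset.mem_filter, not_and] at hf
        exact Finset.mem_filter.2 ⟨hxD, rfl, hf hxD⟩
  refine (Finset.card_le_card hsub).trans ((Finset.card_union_le _ _).trans ?_)
  gcongr
  refine (Finset.card_biUnion_le_card_mul _ _ (k - 1) fun y _ => ?_).trans ?_
  · have := P.card_not_full_lt y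
    omega
  · gcongr
    exact (List.toFinset_card_le _).trans ((List.length_map _).le.trans h.length_le)

theorem le_card_markedSet (hik : i < k) : c / k * t ≤ (markedSet F D L).card := by
  have h1 : ((P.full.filter fun x => ∃ e ∈ L, e.2 = F x).card : ℝ) ≤
      k * (markedSet F D L).card := by
    exact_mod_cast (h.card_full_le hik).trans (Nat.mul_le_mul_left k (Finset.card_filter_le _ _))
  have hk : (0 : ℝ) < k := by exact_mod_cast (Nat.zero_le i).trans_lt hik
  rw [div_mul_eq_mul_div, div_le_iff₀ hk, mul_comm _ (k : ℝ)]
  exact h.le_card_full.trans h1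

/-- With `τ` full-block inputs over images of `L`, `K` solutions and `w` of them in full blocks: `K
≤ τ + tk`, `ct ≤ τ` and `τ ≤ kw`, hence `cK ≤ (c + k)τ ≤ k(c + k)w`. This ratio is the chance `p`
that a draw hits a full block. -/
theorem le_card_markedSet_full (hik : i < k) (hc : 0 < c) :
    c / (k * (c + k)) * (markedSet F D L).card ≤
      ((markedSet F D L).filter fun x => x ∈ P.full).card := by
  have hk : (0 : ℝ) < k := by exact_mod_cast (Nat.zero_le i).trans_lt hik
  set τ := ((P.full.filter fun x => ∃ e ∈ L, e.2 = F x).card : ℝ) with hτ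
  have h1 : τ ≤ k * ((markedSet F D L).filter fun x => x ∈ P.full).card := by
    rw [hτ]
    exact_mod_cast h.card_full_le hik
  have h2 : ((markedSet F D L).card : ℝ) ≤ τ + t * k := by
    have : (markedSet F D L).card ≤
      (P.full.filter fun x => ∃ e ∈ L, e.2 = F x).card + t * k :=
      h.card_markedSet_le.trans (by gcongr; omega)
    rw [hτ]
    exact_mod_cast this
  have h3 := h.le_card_full
  rw [← hτ] at h3
  rw [div_mul_eq_mul_div, div_le_iff₀ (by positivity)]
  calc c * ((markedSet F D L).card : ℝ) ≤ c * (τ + t * k) := by gcongr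
    _ ≤ τ * (c + k) := by nlinarith
    _ ≤ _ := by
      rw [← mul_assoc, mul_comm _ (k : ℝ)]
      gcongr

end GoodDatabase

end BlockPartition

end Blocks

/-! ### Building one database -/

section Stages

set_option linter.unusedSectionVars false

variable {X : Type u} {Y : Type v} [Fintype X] [Fintype Y] [DecidableEq X] [DecidableEq Y]

theorem exists_extend_eq_some {L : Database X Y} {p : X × Y} (h : Marked L p) :
    ∃ S, (S, p.2) ∈ L ∧ p.1 ∉ S ∧ extend L p = some (insert p.1 S, p.2) := by
  obtain ⟨h1, e, he, hep⟩ := h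
  obtain ⟨e', he'⟩ : ∃ e', L.find? (fun e => e.2 = p.2) = some e' := by
    rw [← Option.isSome_iff_exists, List.find?_isSome]
    exact ⟨e, he, by simpa using hep⟩
  have h2 := List.mem_of_find?_eq_some he'
  have h3 := List.find?_some he'
  simp only [decide_eq_true_eq] at h3
  refine ⟨e'.1, by rw [← h3]; exact h2, h1 e' h2, ?_⟩
  simp [extend, he']

/-- Equal extensions have equal images, so both searches extended the same first entry, which
contains neither input. Hence a collision found twice means that one input was drawn twice, which is
a repeated block. -/
theorem eq_of_extend_eq {L : Database X Y} {p q : X × Y} (hp : Marked L p) (hq : Marked L q)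
    (h : extend L p = extend L q) : p.1 = q.1 := by
  obtain ⟨S, hS, hpS, hS'⟩ := exists_extend_eq_some hp
  obtain ⟨T, hT, hqT, hT'⟩ := exists_extend_eq_some hq
  have h2 : p.2 = q.2 := by
    rw [hS', hT'] at h
    simp only [Option.some.injEq, Prod.mk.injEq] at h
    exact h.2
  obtain ⟨e, he⟩ : ∃ e, L.find? (fun e => e.2 = p.2) = some e := by
    rw [← Option.isSome_iff_exists, List.find?_isSome]
    exact ⟨_, hS, by simp⟩
  have he' : L.find? (fun e => e.2 = q.2) = some e := by rw [← h2]; exact he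
  have h3 := hp.1 e (List.mem_of_find?_eq_some he)
  simp only [extend, he, he', Option.map_some, Option.some.injEq, Prod.mk.injEq] at h
  have h4 : p.1 ∈ insert q.1 e.1 := h.1 ▸ Finset.mem_insert_self _ _
  exact (Finset.mem_insert.1 h4).resolve_right h3

/-- The entry that results from extending `L` by the solution `x`. -/
def extendInput (F : X → Y) (L : Database X Y) (x : X) : Finset X × Y :=
  (extend L (x, F x)).getD ({x}, F x)

variable {F : X → Y} {D : Finset X} {k : ℕ} (P : BlockPartition F D k)

theorem extend_eq_extendInput {L : Database X Y} {x : X} (hx : x ∈ markedSet F D L) :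
    extend L (x, F x) = some (extendInput F L x) := by
  obtain ⟨S, -, -, h⟩ := exists_extend_eq_some (Finset.mem_filter.1 hx).2
  simp [extendInput, h]

/-! ### The drawn inputs of one stage as a random process -/

namespace BlockPartition

/-- An upper bound for the probability that after `n` more draws the list `xs` of drawn inputs has
two inputs in the same block, or has few inputs in blocks of `k` inputs, or a draw fails. -/
def potential (p ε Λ : ℝ) (n : ℕ) (xs : List X) : ℝ :=
  (if (xs.map P.label).Nodup then 0 else 1) + n * ε +
    Λ * ((1 / 2) ^ xs.countP (· ∈ P.full) * (1 - p / 2) ^ n)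

theorem potential_nonneg {p ε Λ : ℝ} (hp : p ≤ 1) (hε : 0 ≤ ε) (hΛ : 0 ≤ Λ) (n : ℕ)
    (xs : List X) : 0 ≤ P.potential p ε Λ n xs := by
  have : 0 ≤ 1 - p / 2 := by linarith
  unfold potential
  positivity

theorem one_le_potential {p ε Λ : ℝ} (hp : p ≤ 1) (hε : 0 ≤ ε) (hΛ : 0 ≤ Λ) (n : ℕ)
    {xs : List X} (hxs : ¬ (xs.map P.label).Nodup) : 1 ≤ P.potential p ε Λ n xs := by
  have : 0 ≤ 1 - p / 2 := by linarith
  unfold potential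
  rw [if_neg hxs, add_assoc]
  have : 0 ≤ n * ε + Λ * ((1 / 2) ^ xs.countP (· ∈ P.full) * (1 - p / 2) ^ n) := by positivity
  linarith

/-- The potential is a supermartingale. The next draw repeats a block with probability at most `η`,
and `ε₀` is reserved for a draw that fails. A draw in a full block halves the last term; this has
probability at least `p`, so on average that term shrinks by a factor of at most `1 - p/2`. -/
theorem potential_step {p ε₀ η Λ : ℝ} (hp : p ≤ 1) (hΛ : 0 ≤ Λ) (n : ℕ) {xs : List X}
    (hxs : (xs.map P.label).Nodup) {W : Finset X} (hWD : W ⊆ D) (hW : W.Nonempty)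
    (hη : xs.length * k ≤ η * W.card)
    (hpW : p * W.card ≤ (W.filter fun x => x ∈ P.full).card) :
    (∑ x ∈ W, P.potential p (ε₀ + η) Λ n (x :: xs)) / W.card + ε₀ ≤
      P.potential p (ε₀ + η) Λ (n + 1) xs := by
  have hWpos : (0 : ℝ) < W.card := by exact_mod_cast hW.card_pos
  have hρ : 0 ≤ 1 - p / 2 := by linarith
  set a : ℝ := Λ * ((1 / 2) ^ xs.countP (· ∈ P.full) * (1 - p / 2) ^ n) with ha
  have ha0 : 0 ≤ a := by positivity
  have hsum : (∑ x ∈ W, P.potential p (ε₀ + η) Λ n (x :: xs)) =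
      (W.filter fun x => P.label x ∈ xs.map P.label).card + W.card * (n * (ε₀ + η)) +
        (W.card - (W.filter fun x => x ∈ P.full).card / 2) * a := by
    have h1 : ∀ x, P.potential p (ε₀ + η) Λ n (x :: xs) =
        (if P.label x ∈ xs.map P.label then 1 else 0) + n * (ε₀ + η) +
          (a - if x ∈ P.full then a / 2 else 0) := by
      intro x
      unfold potential
      simp only [List.map_cons, List.nodup_cons, List.countP_cons]
      congr 1
      · by_cases h : P.label x ∈ xs.map P.label <;> simp [h, hxs]
      · by_cases h : x ∈ P.full
        · simp only [h, decide_true, if_true, pow_succ, ha]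
          ring
        · simp [h, ha]
    simp_rw [h1]
    rw [Finset.sum_add_distrib, Finset.sum_add_distrib, Finset.sum_sub_distrib, Finset.sum_boole,
      ← Finset.sum_filter]
    simp only [Finset.sum_const, nsmul_eq_mul]
    ring
  have hgoal : P.potential p (ε₀ + η) Λ (n + 1) xs =
      (n + 1) * (ε₀ + η) + (1 - p / 2) * a := by
    unfold potential
    rw [if_pos hxs, ha]
    push_cast
    ring
  have hd : ((W.filter fun x => P.label x ∈ xs.map P.label).card : ℝ) ≤ η * W.card := by
    refine le_trans ?_ hη
    exact_mod_cast P.card_label_mem_le hWD xs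
  rw [hsum, hgoal, ← le_sub_iff_add_le, div_le_iff₀ hWpos]
  nlinarith

variable [AddCommGroup Y]

/-- The potential bounds the probability that the searches for extensions of `L` end badly. -/
theorem expect_collect_le (hD : D.Nonempty) {L : Database X Y}
    (hK : 0 < (markedSet F D L).card) {R : ℕ} (hR : 0 < R) {t : ℕ} {p ε₀ η Λ : ℝ} (hp : p ≤ 1)
    (hε₀ : 54 * Real.sqrt (D.card / (markedSet F D L).card) / R ≤ ε₀) (hΛ : 0 ≤ Λ)
    (hη : t * k ≤ η * (markedSet F D L).card)
    (hpW : p * (markedSet F D L).card ≤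
      ((markedSet F D L).filter fun x => x ∈ P.full).card)
    {g : Option (Database X Y) → ℝ≥0∞} (hg : ∀ o, g o ≤ 1)
    (hgs : ∀ xs : List X, (∀ x ∈ xs, x ∈ markedSet F D L) → xs.length = t →
      (xs.map P.label).Nodup → g (some (xs.map (extendInput F L))) ≤
        ENNReal.ofReal (Λ * (1 / 2) ^ xs.countP (· ∈ P.full)))
    (n : ℕ) (xs : List X) (hxs : ∀ x ∈ xs, x ∈ markedSet F D L) (hn : n + xs.length = t) :
    (collect D hD R L n (xs.map (extendInput F L))).expect F (fun r => g r.1) ≤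
      ENNReal.ofReal (P.potential p (ε₀ + η) Λ n xs) := by
  have hKr : (0 : ℝ) < (markedSet F D L).card := by exact_mod_cast hK
  have hη0 : 0 ≤ η := by
    by_contra h
    rw [not_le] at h
    have h1 : (0 : ℝ) ≤ t * k := by positivity
    nlinarith
  have hε₀0 : 0 ≤ ε₀ := le_trans (by positivity) hε₀
  have hε : 0 ≤ ε₀ + η := by linarith
  induction n generalizing xs with
  | zero =>
    by_cases hnd : (xs.map P.label).Nodup
    · rw [collect, QProg.expect_ret]
      refine (hgs xs hxs (by omega) hnd).trans (ENNReal.ofReal_le_ofReal ?_)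
      simp [potential, hnd]
    · refine (QProg.expect_le_of_le F _ fun r => hg r.1).trans ?_
      rw [ENNReal.one_le_ofReal]
      exact P.one_le_potential hp hε hΛ _ hnd
  | succ n ih =>
    by_cases hnd : (xs.map P.label).Nodup
    swap
    · refine (QProg.expect_le_of_le F _ fun r => hg r.1).trans ?_
      rw [ENNReal.one_le_ofReal]
      exact P.one_le_potential hp hε hΛ _ hnd
    rw [collect, QProg.expect_bind]
    -- A failed search counts as `1`, a found input as the potential of the longer list. If the
    -- collision is a repetition, the longer list repeats a block and its potential is at least `1`.
    have hpt : ∀ r ∈ ((groverSearch D hD L R 1).dist F).support,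
        (match r.1.bind (extend L) with
          | none => QProg.ret none
          | some e => if e ∈ xs.map (extendInput F L) then QProg.ret none
              else collect D hD R L n (e :: xs.map (extendInput F L)) : QProg X Y _).expect F
            (fun s => g s.1) ≤
          (if r.1 = none then 1 else 0) + r.1.elim 0
            fun q => ENNReal.ofReal (P.potential p (ε₀ + η) Λ n (q.1 :: xs)) := by
      rintro ⟨o, m⟩ hr
      cases o with
      | none => simpa using QProg.expect_le_of_le F _ fun r => hg r.1
      | some q =>
        obtain ⟨x, y⟩ := q
        obtain ⟨hx, hy, hm⟩ := (groverSearch_support F D L hD R 1 _ hr).2 _ rfl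
        change y = F x at hy
        subst hy
        have hxW : x ∈ markedSet F D L := Finset.mem_filter.2 ⟨hx, hm⟩
        simp only [Option.bind_some, extend_eq_extendInput hxW, Option.elim_some, reduceCtorEq,
          if_false, zero_add]
        split_ifs with hmem
        · refine (QProg.expect_le_of_le F _ fun r => hg r.1).trans ?_
          rw [ENNReal.one_le_ofReal]
          refine P.one_le_potential hp hε hΛ _ ?_
          obtain ⟨x', hx', heq⟩ := List.mem_map.1 hmem
          have h2 : x' = x := by
            refine eq_of_extend_eq (Finset.mem_filter.1 (hxs x' hx')).2 hm ?_
            rw [extend_eq_extendInput (hxs x' hx'), heq, extend_eq_extendInput hxW]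
          rw [List.map_cons, List.nodup_cons, not_and]
          intro hnot
          exact absurd (List.mem_map_of_mem (h2 ▸ hx')) hnot
        · refine ih (x :: xs) ?_ ?_
          · intro x' hx'
            rcases List.mem_cons.1 hx' with rfl | h
            · exact hxW
            · exact hxs x' h
          · rw [List.length_cons]
            omega
    refine (QProg.expect_mono F _ hpt).trans ?_
    rw [QProg.expect_add]
    refine (add_le_add (expect_groverSearch_none F D L hD hK hR)
      (expect_groverSearch_le F D L hD hK R 1 _)).trans ?_
    rw [← ENNReal.ofReal_sum_of_nonneg fun x _ => P.potential_nonneg hp hε hΛ _ _,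
      ← ENNReal.ofReal_natCast (markedSet F D L).card, ← ENNReal.ofReal_div_of_pos hKr,
      ← ENNReal.ofReal_add (by positivity) (div_nonneg (Finset.sum_nonneg fun x _ =>
        P.potential_nonneg hp hε hΛ _ _) hKr.le)]
    refine ENNReal.ofReal_le_ofReal ?_
    have hstep := P.potential_step (ε₀ := ε₀) (η := η) hp hΛ n hnd
      (W := markedSet F D L) (Finset.filter_subset _ _) (Finset.card_pos.1 hK)
      (hη := le_trans (by gcongr; omega) hη) hpW
    linarith

/-- Sampling is without replacement: a draw is uniform among the inputs not yet drawn. The summands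
`t` in `hη` and `hpW` compensate for the fewer than `t` inputs missing at that time. -/
theorem expect_sampleInputs_le {t : ℕ} {p η Λ : ℝ} (hp : p ≤ 1) (hΛ : 0 ≤ Λ)
    (ht : t < D.card) (hη0 : 0 ≤ η) (hη : t * k ≤ η * (D.card - t))
    (hpW : p * D.card + t ≤ P.full.card) (hp0 : 0 ≤ p)
    {g : Option (Database X Y) → ℝ≥0∞} (hg : ∀ o, g o ≤ 1)
    (hgs : ∀ xs : List X, (∀ x ∈ xs, x ∈ D) → xs.length = t →
      (xs.map P.label).Nodup → g (some (xs.map fun x => ({x}, F x))) ≤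
        ENNReal.ofReal (Λ * (1 / 2) ^ xs.countP (· ∈ P.full)))
    (n : ℕ) (xs : List X) (hxs : ∀ x ∈ xs, x ∈ D) (hn : n + xs.length = t) :
    (sampleInputs D n (xs.map fun x => ({x}, F x))).expect F (fun r => g r.1) ≤
      ENNReal.ofReal (P.potential p η Λ n xs) := by
  induction n generalizing xs with
  | zero =>
    by_cases hnd : (xs.map P.label).Nodup
    · rw [sampleInputs, QProg.expect_ret]
      refine (hgs xs hxs (by omega) hnd).trans (ENNReal.ofReal_le_ofReal ?_)
      simp [potential, hnd]
    · refine (QProg.expect_le_of_le F _ fun r => hg r.1).trans ?_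
      rw [ENNReal.one_le_ofReal]
      exact P.one_le_potential hp hη0 hΛ _ hnd
  | succ n ih =>
    by_cases hnd : (xs.map P.label).Nodup
    swap
    · refine (QProg.expect_le_of_le F _ fun r => hg r.1).trans ?_
      rw [ENNReal.one_le_ofReal]
      exact P.one_le_potential hp hη0 hΛ _ hnd
    set W := D.filter fun x => ∀ e ∈ xs.map (fun x => (({x} : Finset X), F x)), x ∉ e.1 with hW
    have hWmem : ∀ x, x ∈ W ↔ x ∈ D ∧ x ∉ xs := by
      intro x
      rw [hW, Finset.mem_filter]
      simp only [List.mem_map, forall_exists_index, and_imp, forall_apply_eq_imp_iff₂,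
        Finset.mem_singleton]
      exact and_congr_right fun _ =>
        ⟨fun h hx => h x hx rfl, fun h a ha hxa => h (hxa ▸ ha)⟩
    -- Used below for `T = D` and for the set of inputs in full blocks.
    have hcard : ∀ T ⊆ D, T.card ≤ (W.filter fun x => x ∈ T).card + xs.length := by
      intro T hT
      have hsub : T ⊆ (W.filter fun x => x ∈ T) ∪ xs.toFinset := by
        intro x hx
        by_cases hxs : x ∈ xs
        · exact Finset.mem_union_right _ (List.mem_toFinset.2 hxs)
        · exact Finset.mem_union_left _ (Finset.mem_filter.2 ⟨(hWmem x).2 ⟨hT hx, hxs⟩, hx⟩)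
      exact (Finset.card_le_card hsub).trans ((Finset.card_union_le _ _).trans
        (by gcongr; exact List.toFinset_card_le _))
    have hWD : W ⊆ D := Finset.filter_subset _ _
    have hWcard : D.card ≤ W.card + xs.length :=
      (hcard D subset_rfl).trans (by gcongr; exact Finset.filter_subset _ _)
    have hxt : xs.length ≤ t := by omega
    have hWne : W.Nonempty := by
      rw [← Finset.card_pos]
      omega
    have hWpos : (0 : ℝ) < W.card := by exact_mod_cast hWne.card_pos
    rw [sampleInputs, dif_pos hWne, QProg.expect_pick]
    have hterm : ∀ x ∈ W, (QProg.run (EuclideanSpace.single (x, (0 : Y)) 1) (norm_basisState _)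
        [.query] fun p => sampleInputs D n
          (({p.1}, p.2) :: xs.map fun x => (({x} : Finset X), F x))).expect F
          (fun r => g r.1) ≤ ENNReal.ofReal (P.potential p η Λ n (x :: xs)) := by
      intro x hx
      have hamp : ∀ q : X × Y, evolve F [.query]
          (EuclideanSpace.single (x, (0 : Y)) (1 : ℂ) : QState X Y) q =
            if q = (x, F x) then 1 else 0 := by
        rintro ⟨x', y⟩
        change oracle F _ (x', y) = _
        rw [oracle_apply]
        by_cases h : x' = x
        · subst h
          simp [sub_eq_zero]
        · simp [h]
      rw [QProg.expect_run, Finset.sum_eq_single (x, F x)]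
      · rw [hamp, if_pos rfl]
        simp only [norm_one, one_pow, ENNReal.ofReal_one, one_mul]
        refine ih (x :: xs) ?_ ?_
        · intro x' hx'
          rcases List.mem_cons.1 hx' with rfl | h
          · exact hWD hx
          · exact hxs x' h
        · rw [List.length_cons]
          omega
      · intro q _ hq
        rw [hamp, if_neg hq]
        simp
      · simp
    calc _ ≤ (∑ x ∈ W, ENNReal.ofReal (P.potential p η Λ n (x :: xs))) / W.card := by
          gcongr with x hx
          exact hterm x hx
      _ = ENNReal.ofReal ((∑ x ∈ W, P.potential p η Λ n (x :: xs)) / W.card) := by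
          rw [← ENNReal.ofReal_sum_of_nonneg fun x _ => P.potential_nonneg hp hη0 hΛ _ _,
            ← ENNReal.ofReal_natCast W.card, ← ENNReal.ofReal_div_of_pos hWpos]
      _ ≤ _ := by
          refine ENNReal.ofReal_le_ofReal ?_
          have hxt' : (xs.length : ℝ) ≤ t := by exact_mod_cast hxt
          have hWcard' : (D.card : ℝ) ≤ W.card + xs.length := by exact_mod_cast hWcard
          have hWD' : (W.card : ℝ) ≤ D.card := by exact_mod_cast Finset.card_le_card hWD
          have hfull : (P.full.card : ℝ) ≤ (W.filter fun x => x ∈ P.full).card + xs.length := by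
            exact_mod_cast hcard P.full (Finset.filter_subset _ _)
          have hstep := P.potential_step (ε₀ := 0) (η := η) hp hΛ n hnd (W := W) hWD hWne
            (by
              calc (xs.length * k : ℝ) ≤ t * k := by gcongr
                _ ≤ η * (D.card - t) := hη
                _ ≤ η * W.card := by gcongr; linarith)
            (by nlinarith)
          simpa using hstep

theorem expect_sampleInputs_queries (n : ℕ) (L : Database X Y) :
    (sampleInputs D n L).expect F (fun r => (r.2 : ℝ≥0∞)) ≤ n := by
  induction n generalizing L with
  | zero => simp [sampleInputs, QProg.expect_ret]
  | succ n ih =>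
    rw [sampleInputs]
    split_ifs with h
    · rw [QProg.expect_pick]
      refine sum_div_card_le _ _ fun x _ => ?_
      rw [QProg.expect_run, ← one_mul ((n + 1 : ℕ) : ℝ≥0∞), ← sum_weights
        (evolve F [.query] (EuclideanSpace.single (x, (0 : Y)) (1 : ℂ) : QState X Y))
        ((norm_evolve F _ _).trans (norm_basisState _)), Finset.sum_mul]
      gcongr with p
      simp only [Nat.cast_add]
      rw [QProg.expect_add, QProg.expect_const]
      gcongr
      · exact ih _
      · simp [queryCount]
    · simp [QProg.expect_ret]

theorem expect_collect_queries (hD : D.Nonempty) {L : Database X Y}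
    (hK : 0 < (markedSet F D L).card) (R n : ℕ) (acc : Database X Y) :
    (collect D hD R L n acc).expect F (fun r => (r.2 : ℝ≥0∞)) ≤
      n * ENNReal.ofReal (54 * Real.sqrt (D.card / (markedSet F D L).card)) := by
  induction n generalizing acc with
  | zero => simp [collect, QProg.expect_ret]
  | succ n ih =>
    rw [collect, QProg.expect_bind]
    refine (QProg.expect_mono F _ (h := fun r => n * ENNReal.ofReal
      (54 * Real.sqrt (D.card / (markedSet F D L).card)) + r.2) fun r _ => ?_).trans ?_
    · simp only [Nat.cast_add]
      rw [QProg.expect_add, QProg.expect_const]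
      gcongr
      cases r.1.bind (extend L) with
      | none => simp [QProg.expect_ret]
      | some e =>
        dsimp only
        split_ifs
        · simp [QProg.expect_ret]
        · exact ih _
    · rw [QProg.expect_add, QProg.expect_const, Nat.cast_add, add_mul, Nat.cast_one, one_mul]
      gcongr
      exact expect_groverSearch_queries F D L hD hK R

end BlockPartition

end Stages

/-! ### The databases consist of collisions -/

section Support

set_option linter.unusedSectionVars false

variable {X : Type u} {Y : Type v} [Fintype X] [Fintype Y] [DecidableEq X] [DecidableEq Y]
  {F : X → Y} {D : Finset X}

theorem IsCollisionList.nil (i : ℕ) : IsCollisionList F i 0 [] := ⟨rfl, by simp, by simp⟩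

/-- The algorithm tests pairs of a set and an image for repetition, whereas the sets themselves have
to be distinct. For `i > 0` the sets are nonempty, so each determines its image. -/
theorem IsCollisionList.cons {i t : ℕ} {L : Database X Y} (hL : IsCollisionList F i t L)
    {A : Finset X} {y : Y} (hA : A.card = i) (hi : 0 < i) (hy : ∀ x ∈ A, F x = y)
    (hnot : (A, y) ∉ L) : IsCollisionList F i (t + 1) ((A, y) :: L) := by
  obtain ⟨h1, h2, h3⟩ := hL
  refine ⟨by simp [h1], ?_, ?_⟩
  · rw [List.map_cons, List.nodup_cons]
    refine ⟨fun hmem => ?_, h2⟩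
    obtain ⟨e, he, heA⟩ := List.mem_map.1 hmem
    obtain ⟨x, hx⟩ : A.Nonempty := Finset.card_pos.1 (by omega)
    have heA' : e.1 = A := heA
    have h4 : e.2 = y := ((h3 e he).2 x (heA'.symm ▸ hx)).symm.trans (hy x hx)
    exact hnot (by rw [← heA', ← h4]; exact he)
  · intro e he
    rcases List.mem_cons.1 he with rfl | he
    · exact ⟨⟨hA, fun x hx x' hx' => (hy x hx).trans (hy x' hx').symm⟩, hy⟩
    · exact h3 e he

variable [AddCommGroup Y]

theorem sampleInputs_support (n : ℕ) (t : ℕ) (L : Database X Y) (hL : IsCollisionList F 1 t L) :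
    ∀ r ∈ ((sampleInputs D n L).dist F).support, ∀ L', r.1 = some L' →
      IsCollisionList F 1 (t + n) L' := by
  induction n generalizing t L with
  | zero =>
    intro r hr L' hL'
    simp only [sampleInputs, QProg.dist, PMF.support_pure, Set.mem_singleton_iff] at hr
    subst hr
    simp only [Option.some.injEq] at hL'
    exact hL' ▸ hL
  | succ n ih =>
    intro r hr L' hL'
    rw [sampleInputs] at hr
    split_ifs at hr with h
    · simp only [QProg.dist, PMF.mem_support_bind_iff, PMF.mem_support_map_iff] at hr
      obtain ⟨x, hx, p, hp, r', hr, rfl⟩ := hr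
      rw [PMF.support_uniformOfFinset, Finset.mem_coe, Finset.mem_filter] at hx
      have hpx : p = (x, F x) := by
        by_contra hne
        rw [PMF.mem_support_iff] at hp
        refine hp ?_
        obtain ⟨x', y⟩ := p
        have h0 : evolve F [.query] (EuclideanSpace.single (x, (0 : Y)) (1 : ℂ) : QState X Y)
            (x', y) = 0 := by
          change oracle F _ (x', y) = _
          rw [oracle_apply]
          by_cases h : x' = x
          · subst h
            have : y ≠ F x' := fun h => hne (by rw [h])
            simp [sub_eq_zero, this]
          · simp [h]
        simp [measure, h0]
      subst hpx
      have hcons : IsCollisionList F 1 (t + 1) (({x}, F x) :: L) := by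
        refine hL.cons (by simp) one_pos (by simp) fun hmem => ?_
        exact hx.2 _ hmem (Finset.mem_singleton_self x)
      have := ih (t + 1) _ hcons r' hr L' hL'
      rwa [add_assoc, add_comm 1 n] at this
    · simp only [QProg.dist, PMF.support_pure, Set.mem_singleton_iff] at hr
      subst hr
      simp at hL'

theorem collect_support (hD : D.Nonempty) (R : ℕ) {i s : ℕ} {L : Database X Y}
    (hL : IsCollisionList F i s L) (n t : ℕ) (acc : Database X Y)
    (hacc : IsCollisionList F (i + 1) t acc) :
    ∀ r ∈ ((collect D hD R L n acc).dist F).support, ∀ L', r.1 = some L' →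
      IsCollisionList F (i + 1) (t + n) L' := by
  induction n generalizing t acc with
  | zero =>
    intro r hr L' hL'
    simp only [collect, QProg.dist, PMF.support_pure, Set.mem_singleton_iff] at hr
    subst hr
    simp only [Option.some.injEq] at hL'
    exact hL' ▸ hacc
  | succ n ih =>
    intro r hr L' hL'
    rw [collect] at hr
    obtain ⟨⟨o, m⟩, ha, b, hb, rfl⟩ := QProg.mem_support_bind F _ _ hr
    have hnone : b ∈ ((QProg.ret none : QProg X Y (Option (Database X Y))).dist F).support →
        False := by
      intro hb
      simp only [QProg.dist, PMF.support_pure, Set.mem_singleton_iff] at hb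
      subst hb
      simp at hL'
    cases o with
    | none => exact (hnone hb).elim
    | some p =>
      obtain ⟨-, hp, hm⟩ := (groverSearch_support F D L hD R 1 _ ha).2 _ rfl
      obtain ⟨S, hS, hpS, hext⟩ := exists_extend_eq_some hm
      simp only [Option.bind_some, hext] at hb
      split_ifs at hb with hmem
      · exact (hnone hb).elim
      · obtain ⟨⟨hcard, -⟩, himg⟩ := hL.2.2 _ hS
        have hcons : IsCollisionList F (i + 1) (t + 1) ((insert p.1 S, p.2) :: acc) := by
          refine hacc.cons ?_ (Nat.succ_pos i) ?_ hmem
          · rw [Finset.card_insert_of_notMem hpS, hcard]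
          · intro x hx
            rcases Finset.mem_insert.1 hx with rfl | hx
            · exact hp.symm
            · exact himg x hx
        have := ih (t + 1) _ hcons b hb L' hL'
        rwa [add_assoc, add_comm 1 n] at this

theorem buildDatabase_support (k : ℕ) (hD : D.Nonempty) (R i : ℕ) :
    ∀ r ∈ ((buildDatabase (Y := Y) k D hD R i).dist F).support, ∀ L, r.1 = some L →
      IsCollisionList F (i + 1) (listSize k (Fintype.card Y) (i + 1)) L := by
  induction i with
  | zero =>
    intro r hr L hL
    simpa using sampleInputs_support _ 0 [] (IsCollisionList.nil 1) r hr L hL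
  | succ i ih =>
    intro r hr L hL
    rw [buildDatabase] at hr
    obtain ⟨⟨o, m⟩, ha, b, hb, rfl⟩ := QProg.mem_support_bind F _ _ hr
    cases o with
    | none =>
      simp only [QProg.dist, PMF.support_pure, Set.mem_singleton_iff] at hb
      subst hb
      simp at hL
    | some L₀ =>
      simpa using collect_support hD R (ih _ ha L₀ rfl) _ 0 [] (IsCollisionList.nil _) b hb L hL

end Support

/-! ### Numerical bounds -/

/-- A Chernoff bound for fewer than `pt/4` hits. With `x = pt/4` the factors are at most `2 exp x`
and `exp (-2x)`. The remaining `2 exp (-x)` is weakened to `2/x`, which suffices since `1/t_i` is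
within the error term for `i < k`. -/
theorem two_pow_ceil_mul_le {p : ℝ} (hp : 0 < p) (hp1 : p ≤ 1) {t : ℕ} (ht : 0 < t) :
    (2 : ℝ) ^ ⌈p / 4 * t⌉₊ * (1 - p / 2) ^ t ≤ 8 / (p * t) := by
  have ht' : (0 : ℝ) < t := by exact_mod_cast ht
  set x := p / 4 * t with hx
  have hx0 : 0 < x := by positivity
  have h1 : (2 : ℝ) ^ ⌈x⌉₊ ≤ 2 * Real.exp x := by
    have h2 : (⌈x⌉₊ : ℝ) ≤ x + 1 := (Nat.ceil_lt_add_one hx0.le).le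
    calc (2 : ℝ) ^ ⌈x⌉₊ = (2 : ℝ) ^ (⌈x⌉₊ : ℝ) := (Real.rpow_natCast _ _).symm
      _ ≤ (2 : ℝ) ^ (x + 1) := Real.rpow_le_rpow_of_exponent_le (by norm_num) h2
      _ = 2 * (2 : ℝ) ^ x := by rw [Real.rpow_add_one (by norm_num), mul_comm]
      _ ≤ 2 * (Real.exp 1) ^ x := by
        gcongr
        linarith [Real.add_one_le_exp (1 : ℝ)]
      _ = _ := by rw [← Real.exp_mul, one_mul]
  have h3 : (1 - p / 2) ^ t ≤ Real.exp (-(2 * x)) := by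
    calc (1 - p / 2) ^ t ≤ (Real.exp (-(p / 2))) ^ t := by
          gcongr
          · linarith
          · linarith [Real.add_one_le_exp (-(p / 2))]
      _ = _ := by rw [← Real.exp_nat_mul, hx]; ring_nf
  calc _ ≤ 2 * Real.exp x * Real.exp (-(2 * x)) := by
        gcongr
        exact pow_nonneg (by linarith) _
    _ = 2 * Real.exp (-x) := by rw [mul_assoc, ← Real.exp_add]; ring_nf
    _ ≤ 2 * x⁻¹ := by
        gcongr
        rw [Real.exp_neg]
        exact inv_anti₀ hx0 (by linarith [Real.add_one_le_exp x])
    _ = _ := by rw [hx]; field_simp; norm_num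

/-- The exponent of the size of the `i`-th database. -/
def sizeExponent (k i : ℕ) : ℝ := ((2 : ℝ) ^ (k - i) - 1) / ((2 : ℝ) ^ k - 1)

theorem two_pow_sub_one_pos {k : ℕ} (hk : 1 ≤ k) : (0 : ℝ) < (2 : ℝ) ^ k - 1 := by
  have : (1 : ℝ) < 2 ^ k := one_lt_pow₀ (by norm_num) (by omega)
  linarith

theorem sizeExponent_nonneg {k : ℕ} (i : ℕ) (hk : 1 ≤ k) : 0 ≤ sizeExponent k i := by
  have h1 : (1 : ℝ) ≤ 2 ^ (k - i) := one_le_pow₀ (by norm_num)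
  exact div_nonneg (by linarith) (two_pow_sub_one_pos hk).le

theorem sizeExponent_zero {k : ℕ} (hk : 1 ≤ k) : sizeExponent k 0 = 1 :=
  div_self (two_pow_sub_one_pos hk).ne'

/-- This is `2^(k-i) - 1 = 2 (2^(k-i-1) - 1) + 1`. Up to rounding it says `t_{i+1}² = t_i
N^(-1/(2^k-1))`, which makes repeated blocks unlikely in every stage. -/
theorem sizeExponent_succ {k i : ℕ} (hik : i < k) :
    sizeExponent k i = 2 * sizeExponent k (i + 1) + 1 / ((2 : ℝ) ^ k - 1) := by
  have h := two_pow_sub_one_pos (show 1 ≤ k by omega)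
  unfold sizeExponent
  rw [show k - i = k - (i + 1) + 1 by omega, pow_succ]
  field_simp
  ring

theorem one_div_two_pow_le {k : ℕ} (hk : 1 ≤ k) :
    1 / (2 : ℝ) ^ k ≤ 1 / ((2 : ℝ) ^ k - 1) :=
  one_div_le_one_div_of_le (two_pow_sub_one_pos hk) (by linarith)

/-- The balance of costs: `t_{i+1}` searches at `√(N/t_i)` queries each amount to `N^e` in every
stage, up to constants. -/
theorem sizeExponent_add_eq {k i : ℕ} (hik : i < k) :
    sizeExponent k (i + 1) + (1 - sizeExponent k i) / 2 = sizeExponent k 1 := by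
  have h := two_pow_sub_one_pos (show 1 ≤ k by omega)
  rw [sizeExponent_succ hik]
  have h0 := sizeExponent_succ (show 0 < k by omega)
  rw [sizeExponent_zero (by omega)] at h0
  linarith

theorem le_sizeExponent {k i : ℕ} (hik : i < k) : 1 / (2 : ℝ) ^ k ≤ sizeExponent k i := by
  rw [sizeExponent_succ hik]
  have := sizeExponent_nonneg (k := k) (i + 1) (by omega)
  have := one_div_two_pow_le (show 1 ≤ k by omega)
  linarith

theorem le_listSize (k N i : ℕ) : (N : ℝ) ^ sizeExponent k i ≤ listSize k N i := Nat.le_ceil _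

theorem listSize_le {k N i : ℕ} (hk : 1 ≤ k) (hN : 1 ≤ N) :
    (listSize k N i : ℝ) ≤ 2 * (N : ℝ) ^ sizeExponent k i := by
  have hN' : (1 : ℝ) ≤ N := by exact_mod_cast hN
  have h1 : 1 ≤ (N : ℝ) ^ sizeExponent k i :=
    Real.one_le_rpow hN' (sizeExponent_nonneg i hk)
  have h2 : (listSize k N i : ℝ) < (N : ℝ) ^ sizeExponent k i + 1 :=
    Nat.ceil_lt_add_one (Real.rpow_nonneg (by linarith) _)
  linarith

theorem listSize_pos {k N i : ℕ} (hN : 1 ≤ N) : 0 < listSize k N i := by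
  have hN' : (0 : ℝ) < N := by exact_mod_cast hN
  exact Nat.ceil_pos.2 (Real.rpow_pos_of_pos hN' _)

theorem listSize_self (k N : ℕ) : listSize k N k = 1 := by simp [listSize]

theorem listSize_sq_le {k N i : ℕ} (hik : i < k) (hN : 1 ≤ N) :
    (listSize k N (i + 1) : ℝ) ^ 2 ≤
      4 * (N : ℝ) ^ (-(1 / 2 ^ k) : ℝ) * (N : ℝ) ^ sizeExponent k i := by
  have hN' : (1 : ℝ) ≤ N := by exact_mod_cast hN
  have hN0 : (0 : ℝ) < N := by linarith
  calc (listSize k N (i + 1) : ℝ) ^ 2 ≤ (2 * (N : ℝ) ^ sizeExponent k (i + 1)) ^ 2 := by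
        gcongr
        exact listSize_le (by omega) hN
    _ = 4 * (N : ℝ) ^ (2 * sizeExponent k (i + 1)) := by
        rw [mul_pow, two_mul, Real.rpow_add hN0]
        ring
    _ ≤ 4 * (N : ℝ) ^ (-(1 / 2 ^ k) + sizeExponent k i : ℝ) := by
        gcongr
        rw [sizeExponent_succ hik]
        have := one_div_two_pow_le (show 1 ≤ k by omega)
        linarith
    _ = _ := by rw [Real.rpow_add hN0, mul_assoc]

theorem one_div_listSize_le {k N i : ℕ} (hik : i < k) (hN : 1 ≤ N) :
    1 / (listSize k N i : ℝ) ≤ (N : ℝ) ^ (-(1 / 2 ^ k) : ℝ) := by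
  have hN' : (1 : ℝ) ≤ N := by exact_mod_cast hN
  have hN0 : (0 : ℝ) < N := by linarith
  calc 1 / (listSize k N i : ℝ) ≤ 1 / (N : ℝ) ^ sizeExponent k i := by
        gcongr
        exact le_listSize k N i
    _ = (N : ℝ) ^ (-sizeExponent k i) := by rw [Real.rpow_neg hN0.le, one_div]
    _ ≤ _ := Real.rpow_le_rpow_of_exponent_le hN' (by linarith [le_sizeExponent hik])

/-- `t` searches among `k N` inputs, with at least `δ s` solutions, make `O(N ^ e)` queries. -/
theorem listSize_mul_sqrt_le {k N i K : ℕ} (hik : i < k) (hN : 1 ≤ N) {δ : ℝ}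
    (hδ : 0 < δ) (hK : δ * listSize k N i ≤ K) :
    (listSize k N (i + 1) : ℝ) * (54 * Real.sqrt ((k * N : ℕ) / K)) ≤
      108 * Real.sqrt (k / δ) * (N : ℝ) ^ sizeExponent k 1 := by
  have hN' : (1 : ℝ) ≤ N := by exact_mod_cast hN
  have hN0 : (0 : ℝ) < N := by linarith
  have hpow : 0 < (N : ℝ) ^ sizeExponent k i := Real.rpow_pos_of_pos hN0 _
  have hs := le_listSize k N i
  have h1 : Real.sqrt ((k * N : ℕ) / K) ≤
      Real.sqrt (k / δ) * (N : ℝ) ^ ((1 - sizeExponent k i) / 2) := by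
    have h2 : (N : ℝ) ^ ((1 - sizeExponent k i) / 2) =
        Real.sqrt ((N : ℝ) / (N : ℝ) ^ sizeExponent k i) := by
      have h3 : (N : ℝ) / (N : ℝ) ^ sizeExponent k i = (N : ℝ) ^ (1 - sizeExponent k i) := by
        rw [Real.rpow_sub hN0, Real.rpow_one]
      rw [h3, Real.sqrt_eq_rpow, ← Real.rpow_mul hN0.le]
      ring_nf
    rw [h2, ← Real.sqrt_mul (by positivity)]
    refine Real.sqrt_le_sqrt ?_
    push_cast
    rw [div_mul_div_comm]
    gcongr
    exact le_trans (by gcongr) hK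
  calc _ ≤ 2 * (N : ℝ) ^ sizeExponent k (i + 1) *
        (54 * (Real.sqrt (k / δ) * (N : ℝ) ^ ((1 - sizeExponent k i) / 2))) := by
        gcongr
        exact listSize_le (by omega) hN
    _ = 108 * Real.sqrt (k / δ) *
        ((N : ℝ) ^ sizeExponent k (i + 1) * (N : ℝ) ^ ((1 - sizeExponent k i) / 2)) := by ring
    _ = _ := by rw [← Real.rpow_add hN0, sizeExponent_add_eq hik]

/-! ### The analysis of the iterated algorithm -/

section Analysis

set_option linter.unusedSectionVars false

open Classical in
/-- The indicator of the event that no good database was built. -/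
def failure {X : Type u} {Y : Type v} (good : Database X Y → Prop) (o : Option (Database X Y)) :
    ℝ≥0∞ := if ∃ L, o = some L ∧ good L then 0 else 1

open Classical in
/-- The number of queries relative to the budget `B`, but at most `1`, if a good database was
built, and `1` otherwise. -/
def score {X : Type u} {Y : Type v} (B : ℕ) (good : Database X Y → Prop)
    (r : Option (Database X Y) × ℕ) : ℝ≥0∞ :=
  if ∃ L, r.1 = some L ∧ good L then min 1 ((r.2 : ℝ≥0∞) / B) else 1

/-- The error `N ^ (-1 / 2 ^ k) + N ^ e / B` of the algorithm with budget `B`. -/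
def errorTerm (k N B : ℕ) : ℝ :=
  (N : ℝ) ^ (-(1 / 2 ^ k) : ℝ) + (N : ℝ) ^ sizeExponent k 1 / B

theorem errorTerm_nonneg (k N B : ℕ) : 0 ≤ errorTerm k N B := by
  unfold errorTerm
  positivity

theorem failure_le_one {X : Type u} {Y : Type v} (good : Database X Y → Prop)
    (o : Option (Database X Y)) : failure good o ≤ 1 := by
  unfold failure
  split_ifs <;> simp

theorem score_le_one {X : Type u} {Y : Type v} (B : ℕ) (good : Database X Y → Prop)
    (r : Option (Database X Y) × ℕ) : score B good r ≤ 1 := by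
  unfold score
  split_ifs
  · exact min_le_left _ _
  · exact le_rfl

/-- Here `m` counts the queries of the current stage and `n` those of earlier ones. Only `n` stays
capped, because the old score already contains that cap, while the expectation of `m` is bounded
directly. -/
theorem score_add_le {X : Type u} {Y : Type v} (B : ℕ) (good : Database X Y → Prop)
    (o : Option (Database X Y)) (m n : ℕ) :
    score B good (o, m + n) ≤
      failure good o + (B : ℝ≥0∞)⁻¹ * m + min 1 ((n : ℝ≥0∞) / B) := by
  unfold score failure
  split_ifs with h
  · rw [zero_add]
    rcases le_total 1 ((n : ℝ≥0∞) / B) with h1 | h1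
    · rw [min_eq_left h1]
      exact (min_le_left _ _).trans le_add_self
    · rw [min_eq_right h1]
      refine (min_le_right _ _).trans_eq ?_
      rw [Nat.cast_add, ENNReal.add_div, ENNReal.div_eq_inv_mul]
  · rw [add_assoc]
    exact le_self_add

variable {X : Type u} {Y : Type v} [Fintype X] [Fintype Y] [DecidableEq X] [DecidableEq Y]
  [AddCommGroup Y] {F : X → Y} {D : Finset X} {k N : ℕ}

/-- If the previous list is not good, its score is already `1` and dominates anything that follows,
so nothing needs to be known about searches in bad lists. Otherwise the stage adds its failure
probability `b` and its relative cost `q / B`. -/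
theorem expect_score_succ_le (hD : D.Nonempty) {B i : ℕ} (hB : 0 < B)
    {good good' : Database X Y → Prop} {a b q : ℝ} (ha : 0 ≤ a) (hb : 0 ≤ b) (hq : 0 ≤ q)
    (h₁ : (buildDatabase (Y := Y) k D hD B i).expect F (score B good) ≤ ENNReal.ofReal a)
    (h₂ : ∀ L, good L → (collect D hD B L (listSize k (Fintype.card Y) (i + 2)) []).expect F
      (fun r => failure good' r.1) ≤ ENNReal.ofReal b)
    (h₃ : ∀ L, good L → (collect D hD B L (listSize k (Fintype.card Y) (i + 2)) []).expect F
      (fun r => (r.2 : ℝ≥0∞)) ≤ ENNReal.ofReal q) :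
    (buildDatabase (Y := Y) k D hD B (i + 1)).expect F (score B good') ≤
      ENNReal.ofReal (a + (b + q / B)) := by
  have hB' : (0 : ℝ) < B := by exact_mod_cast hB
  have hqB : (B : ℝ≥0∞)⁻¹ * ENNReal.ofReal q = ENNReal.ofReal (q / B) := by
    rw [ENNReal.ofReal_div_of_pos hB', ENNReal.ofReal_natCast, ENNReal.div_eq_inv_mul]
  rw [buildDatabase, QProg.expect_bind]
  refine (QProg.expect_mono F _ (h := fun r => score B good r + ENNReal.ofReal (b + q / B))
    fun r _ => ?_).trans ?_
  · by_cases hr : ∃ L, r.1 = some L ∧ good L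
    · obtain ⟨L, hL, hgood⟩ := hr
      have hs : score B good r = min 1 ((r.2 : ℝ≥0∞) / B) := if_pos ⟨L, hL, hgood⟩
      rw [hs]
      simp only [hL]
      refine (QProg.expect_mono F _ fun s _ => score_add_le B good' s.1 s.2 r.2).trans ?_
      rw [QProg.expect_add, QProg.expect_add, QProg.expect_const, QProg.expect_const_mul,
        add_comm, ENNReal.ofReal_add hb (by positivity), ← hqB]
      gcongr
      · exact h₂ L hgood
      · exact h₃ L hgood
    · have hs : score B good r = 1 := if_neg hr
      rw [hs]
      exact (QProg.expect_le_of_le F _ fun s => score_le_one B good' _).trans le_self_add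
  · rw [QProg.expect_add, QProg.expect_const, ENNReal.ofReal_add ha (by positivity)]
    gcongr

/-! ### Failure probability and cost of a single stage -/

namespace BlockPartition

variable (P : BlockPartition F D k)

/-- Once the blocks are distinct, the list can only be bad if fewer than `⌈pt/4⌉` draws were in full
blocks, and then the right-hand side is at least `1`. This fixes `Λ = 2 ^ ⌈pt/4⌉` in the potential.
-/
theorem failure_goodDatabase_le {i t : ℕ} {p : ℝ} {L : Database X Y}
    (hL : ∀ b, ((P.block b).filter fun x => ∃ e ∈ L, x ∈ e.1).card ≤ i)
    (f : X → Finset X × Y) {xs : List X}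
    (hf₁ : ∀ x ∈ xs, ∀ x' ∈ (f x).1, x' = x ∨ ∃ e ∈ L, x' ∈ e.1)
    (hf₂ : ∀ x ∈ xs, (f x).2 = F x) (hlen : xs.length = t) (hxs : (xs.map P.label).Nodup) :
    failure (P.GoodDatabase (i + 1) t (p / 4)) (some (xs.map f)) ≤
      ENNReal.ofReal (2 ^ ⌈p / 4 * t⌉₊ * (1 / 2) ^ xs.countP (· ∈ P.full)) := by
  rcases le_or_gt ⌈p / 4 * t⌉₊ (xs.countP (· ∈ P.full)) with h | h
  · have hc : p / 4 * t ≤ xs.countP (· ∈ P.full) := Nat.ceil_le.1 h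
    have hgood := P.goodDatabase_of_inputs hL f hf₁ hf₂ hlen hxs hc
    unfold failure
    rw [if_pos ⟨_, rfl, hgood⟩]
    exact zero_le
  · refine (failure_le_one _ _).trans ?_
    rw [ENNReal.one_le_ofReal]
    calc (1 : ℝ) = 2 ^ xs.countP (· ∈ P.full) * (1 / 2) ^ xs.countP (· ∈ P.full) := by
          rw [← mul_pow]; norm_num
      _ ≤ _ := by gcongr; norm_num

/-- `t_1 ≤ 2√N`, as its exponent is at most `1/2`, and `2√N ≤ N/2` as soon as `√N ≥ 4`. So the
sample leaves at least half of `N` inputs in full blocks undrawn. -/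
theorem listSize_one_le {N : ℕ} (hk : 1 ≤ k) (hN : 16 ≤ N) :
    (listSize k N 1 : ℝ) ≤ N / 2 := by
  have hN' : (16 : ℝ) ≤ N := by exact_mod_cast hN
  have h1 : sizeExponent k 1 ≤ 1 / 2 := by
    have h := sizeExponent_succ (show 0 < k by omega)
    rw [sizeExponent_zero hk] at h
    have := one_div_nonneg.2 (two_pow_sub_one_pos hk).le
    linarith
  have h2 : (N : ℝ) ^ sizeExponent k 1 ≤ Real.sqrt N := by
    rw [Real.sqrt_eq_rpow]
    exact Real.rpow_le_rpow_of_exponent_le (by linarith) h1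
  have h3 : (4 : ℝ) ≤ Real.sqrt N := Real.le_sqrt_of_sq_le (by norm_num; exact_mod_cast hN)
  have h4 : Real.sqrt N * Real.sqrt N = N := Real.mul_self_sqrt (by linarith)
  have h5 := listSize_le (i := 1) hk (show 1 ≤ N by omega)
  nlinarith

theorem expect_sampleInputs_failure_le (hk : 1 ≤ k) (hN : N = Fintype.card Y) (hN16 : 16 ≤ N)
    (hDN : D.card = k * N) {Λ : ℝ} (hΛ : 0 ≤ Λ) {g : Option (Database X Y) → ℝ≥0∞}
    (hg : ∀ o, g o ≤ 1)
    (hgs : ∀ xs : List X, (∀ x ∈ xs, x ∈ D) → xs.length = listSize k N 1 →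
      (xs.map P.label).Nodup → g (some (xs.map fun x => ({x}, F x))) ≤
        ENNReal.ofReal (Λ * (1 / 2) ^ xs.countP (· ∈ P.full))) :
    (sampleInputs D (listSize k N 1) []).expect F (fun r => g r.1) ≤
      ENNReal.ofReal (8 * (N : ℝ) ^ (-(1 / 2 ^ k) : ℝ) +
        Λ * (1 - 1 / (2 * k) / 2) ^ listSize k N 1) := by
  set t := listSize k N 1 with ht
  have hN' : (16 : ℝ) ≤ N := by exact_mod_cast hN16
  have hk' : (1 : ℝ) ≤ k := by exact_mod_cast hk
  have ht2 : (t : ℝ) ≤ N / 2 := listSize_one_le hk hN16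
  have hDr : (D.card : ℝ) = k * N := by rw [hDN]; push_cast; ring
  have hkN : (N : ℝ) ≤ k * N := by nlinarith
  have hfull : (N : ℝ) ≤ P.full.card := by
    exact_mod_cast P.card_le_card_full N hN hDN (by omega)
  -- With `p = 1/(2k)`, `p |D| + t = N/2 + t ≤ N`. With `η = 2t/N`, the bound on `η` amounts to `t ≤
  -- kN/2`, and `t` draws contribute `tη = 2t²/N`.
  have h := P.expect_sampleInputs_le (t := t) (p := 1 / (2 * k)) (η := 2 * t / N) (Λ := Λ)
    (by rw [div_le_one (by positivity)]; linarith) hΛ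
    (by
      have : (t : ℝ) < D.card := by rw [hDr]; linarith
      exact_mod_cast this)
    (by positivity)
    (by
      rw [hDr, div_mul_eq_mul_div, le_div_iff₀ (by linarith)]
      have : (0 : ℝ) ≤ t := by positivity
      nlinarith)
    (by
      rw [hDr]
      have : 1 / (2 * (k : ℝ)) * (k * N) = N / 2 := by field_simp
      rw [this]
      linarith)
    (by positivity) hg hgs t [] (by simp) (by simp)
  refine h.trans (ENNReal.ofReal_le_ofReal ?_)
  have hsq := listSize_sq_le (show 0 < k by omega) (show 1 ≤ N by omega)
  rw [sizeExponent_zero hk, Real.rpow_one, zero_add, ← ht] at hsq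
  have h1 : t * (2 * t / N) ≤ 8 * (N : ℝ) ^ (-(1 / 2 ^ k) : ℝ) := by
    rw [mul_div_assoc', div_le_iff₀ (by linarith)]
    linarith
  simp only [potential, List.map_nil, List.nodup_nil, if_true, List.countP_nil, pow_zero, zero_add,
    one_mul]
  linarith

theorem expect_collect_failure_le (hD : D.Nonempty) (hN : 1 ≤ N) (hDN : D.card = k * N) {i : ℕ}
    (hik : i < k) {c : ℝ} (hc : 0 < c) {L : Database X Y}
    (hL : P.GoodDatabase i (listSize k N i) c L) {B : ℕ} (hB : 0 < B) {Λ : ℝ} (hΛ : 0 ≤ Λ)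
    {g : Option (Database X Y) → ℝ≥0∞} (hg : ∀ o, g o ≤ 1)
    (hgs : ∀ xs : List X, (∀ x ∈ xs, x ∈ markedSet F D L) → xs.length = listSize k N (i + 1) →
      (xs.map P.label).Nodup → g (some (xs.map (extendInput F L))) ≤
        ENNReal.ofReal (Λ * (1 / 2) ^ xs.countP (· ∈ P.full))) :
    (collect D hD B L (listSize k N (i + 1)) []).expect F (fun r => g r.1) ≤
      ENNReal.ofReal (108 * Real.sqrt (k / (c / k)) * (N : ℝ) ^ sizeExponent k 1 / B +
        4 * k / (c / k) * (N : ℝ) ^ (-(1 / 2 ^ k) : ℝ) +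
        Λ * (1 - c / (k * (c + k)) / 2) ^ listSize k N (i + 1)) := by
  set t := listSize k N (i + 1) with ht
  have hk' : (1 : ℝ) ≤ k := by
    have : 1 ≤ k := by omega
    exact_mod_cast this
  have hB' : (0 : ℝ) < B := by exact_mod_cast hB
  have htpos : (0 : ℝ) < t := by exact_mod_cast listSize_pos hN
  have hspos : (0 : ℝ) < listSize k N i := by exact_mod_cast listSize_pos hN
  have hKle := hL.le_card_markedSet hik
  have hK : 0 < (markedSet F D L).card := by
    have : (0 : ℝ) < (markedSet F D L).card := lt_of_lt_of_le (by positivity) hKle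
    exact_mod_cast this
  have hcost := listSize_mul_sqrt_le hik hN (show 0 < c / k by positivity) hKle
  rw [← ht, ← hDN] at hcost
  set A := 108 * Real.sqrt (k / (c / k)) * (N : ℝ) ^ sizeExponent k 1 with hA
  -- `A` bounds the expected cost of all `t` searches, so one search costs at most `A / t` and
  -- exhausts its `B` rounds with probability at most `A / t / B`. The denominator in `η` is the
  -- guaranteed number of solutions.
  have h := P.expect_collect_le hD hK hB (t := t) (p := c / (k * (c + k)))
    (ε₀ := A / t / B) (η := t * k / (c / k * listSize k N i)) (Λ := Λ)
    (by
      rw [div_le_one (by positivity)]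
      nlinarith)
    (by
      gcongr
      rw [le_div_iff₀ htpos]
      linarith)
    hΛ
    (by
      rw [div_mul_eq_mul_div, le_div_iff₀ (by positivity)]
      gcongr)
    (hL.le_card_markedSet_full hik hc) hg hgs t [] (by simp) (by simp)
  refine h.trans (ENNReal.ofReal_le_ofReal ?_)
  have hsq := listSize_sq_le hik hN
  rw [← ht] at hsq
  have h1 : t * (A / t / B) = A / B := by field_simp
  have h2 : t * (t * k / (c / k * listSize k N i)) ≤
      4 * k / (c / k) * (N : ℝ) ^ (-(1 / 2 ^ k) : ℝ) := by
    have h3 : t * (t * k / (c / k * listSize k N i)) =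
        k / (c / k) * ((t : ℝ) ^ 2 / listSize k N i) := by field_simp
    have h4 : (t : ℝ) ^ 2 / listSize k N i ≤ 4 * (N : ℝ) ^ (-(1 / 2 ^ k) : ℝ) := by
      rw [div_le_iff₀ hspos]
      refine hsq.trans ?_
      gcongr
      exact le_listSize k N i
    rw [h3]
    calc _ ≤ k / (c / k) * (4 * (N : ℝ) ^ (-(1 / 2 ^ k) : ℝ)) := by gcongr
      _ = _ := by ring
  simp only [potential, List.map_nil, List.nodup_nil, if_true, List.countP_nil, pow_zero, zero_add,
    one_mul, mul_add]
  linarith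

theorem expect_collect_queries_le (hD : D.Nonempty) (hN : 1 ≤ N) (hDN : D.card = k * N) {i : ℕ}
    (hik : i < k) {c : ℝ} (hc : 0 < c) {L : Database X Y}
    (hL : P.GoodDatabase i (listSize k N i) c L) (B : ℕ) :
    (collect D hD B L (listSize k N (i + 1)) []).expect F (fun r => (r.2 : ℝ≥0∞)) ≤
      ENNReal.ofReal (108 * Real.sqrt (k / (c / k)) * (N : ℝ) ^ sizeExponent k 1) := by
  have hk' : (0 : ℝ) < k := by exact_mod_cast (Nat.zero_le i).trans_lt hik
  have hspos : (0 : ℝ) < listSize k N i := by exact_mod_cast listSize_pos hN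
  have hKle := hL.le_card_markedSet hik
  have hK : 0 < (markedSet F D L).card := by
    have : (0 : ℝ) < (markedSet F D L).card := lt_of_lt_of_le (by positivity) hKle
    exact_mod_cast this
  refine (expect_collect_queries hD hK B _ []).trans ?_
  rw [← ENNReal.ofReal_natCast, ← ENNReal.ofReal_mul (by positivity), hDN]
  exact ENNReal.ofReal_le_ofReal (listSize_mul_sqrt_le hik hN (by positivity) hKle)

theorem expect_sampleInputs_score_le (hk : 1 ≤ k) (hN : 1 ≤ N) {B : ℕ} (hB : 0 < B)
    {good : Database X Y → Prop} {a : ℝ} (ha : 0 ≤ a)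
    (h : (sampleInputs D (listSize k N 1) []).expect F (fun r => failure good r.1) ≤
      ENNReal.ofReal a) :
    (sampleInputs D (listSize k N 1) []).expect F (score B good) ≤
      ENNReal.ofReal (a + 2 * (N : ℝ) ^ sizeExponent k 1 / B) := by
  have hB' : (0 : ℝ) < B := by exact_mod_cast hB
  refine (QProg.expect_mono F _ fun r _ => score_add_le B good r.1 r.2 0).trans ?_
  rw [QProg.expect_add, QProg.expect_add, QProg.expect_const, QProg.expect_const_mul,
    ENNReal.ofReal_add ha (by positivity), ENNReal.ofReal_div_of_pos hB', ENNReal.ofReal_natCast]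
  simp only [Nat.cast_zero, ENNReal.zero_div, min_zero, add_zero]
  rw [ENNReal.div_eq_inv_mul]
  gcongr
  refine (expect_sampleInputs_queries (F := F) (D := D) _ []).trans ?_
  rw [← ENNReal.ofReal_natCast]
  exact ENNReal.ofReal_le_ofReal (listSize_le hk hN)

end BlockPartition

theorem rpow_neg_le_errorTerm (k N B : ℕ) :
    (N : ℝ) ^ (-(1 / 2 ^ k) : ℝ) ≤ errorTerm k N B := by
  unfold errorTerm
  have : 0 ≤ (N : ℝ) ^ sizeExponent k 1 / B := by positivity
  linarith

theorem rpow_div_le_errorTerm (k N B : ℕ) :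
    (N : ℝ) ^ sizeExponent k 1 / B ≤ errorTerm k N B := by
  unfold errorTerm
  have : 0 ≤ (N : ℝ) ^ (-(1 / 2 ^ k) : ℝ) := by positivity
  linarith

theorem tail_le {k N i : ℕ} (hik : i < k) (hN : 1 ≤ N) {p : ℝ} (hp : 0 < p) (hp1 : p ≤ 1) :
    (2 : ℝ) ^ ⌈p / 4 * (listSize k N i : ℕ)⌉₊ * (1 - p / 2) ^ listSize k N i ≤
      8 / p * (N : ℝ) ^ (-(1 / 2 ^ k) : ℝ) := by
  refine (two_pow_ceil_mul_le hp hp1 (listSize_pos hN)).trans ?_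
  rw [show 8 / (p * (listSize k N i : ℝ)) = 8 / p * (1 / listSize k N i) by
    rw [div_mul_div_comm, mul_one]]
  gcongr
  exact one_div_listSize_le hik hN

end Analysis

/-- The databases before the last one are good, and cost few queries, with high probability. -/
theorem exists_expect_score_goodDatabase_le (k i : ℕ) (hik : i + 1 < k) :
    ∃ c C : ℝ, 0 < c ∧ 0 ≤ C ∧
      ∀ (X : Type u) (Y : Type v) [Fintype X] [Fintype Y] [DecidableEq X] [DecidableEq Y]
        [AddCommGroup Y] (F : X → Y) (N : ℕ), N = Fintype.card Y → 16 ≤ N →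
        ∀ (D : Finset X) (hD : D.Nonempty) (P : BlockPartition F D k), D.card = k * N →
        ∀ B : ℕ, 0 < B →
          (buildDatabase (Y := Y) k D hD B i).expect F
            (score B (P.GoodDatabase (i + 1) (listSize k N (i + 1)) c)) ≤
          ENNReal.ofReal (C * errorTerm k N B) := by
  have hk' : (1 : ℝ) ≤ k := by
    have : 1 ≤ k := by omega
    exact_mod_cast this
  induction i with
  | zero =>
    set p : ℝ := 1 / (2 * k) with hp
    have hp0 : 0 < p := by positivity
    have hp1 : p ≤ 1 := by rw [hp, div_le_one (by positivity)]; linarith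
    -- The constant collects repeated blocks `8`, too few full draws `8 / p` and the sampling
    -- queries `2`.
    refine ⟨p / 4, 8 + 8 / p + 2, by positivity, by positivity, ?_⟩
    intro X Y _ _ _ _ _ F N hN hN16 D hD P hDN B hB
    have h1 := P.expect_sampleInputs_failure_le (k := k) (by omega) hN hN16 hDN
      (Λ := 2 ^ ⌈p / 4 * (listSize k N 1 : ℕ)⌉₊) (by positivity)
      (g := failure (P.GoodDatabase (0 + 1) (listSize k N 1) (p / 4))) (failure_le_one _)
      (fun xs hxs hlen hnd => P.failure_goodDatabase_le (L := []) (by simp)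
        (fun x => ({x}, F x)) (by simp) (by simp) hlen hnd)
    rw [buildDatabase, ← hN]
    refine (BlockPartition.expect_sampleInputs_score_le (by omega) (by omega) hB ?_ h1).trans ?_
    · have : 0 ≤ 1 - p / 2 := by linarith
      positivity
    · refine ENNReal.ofReal_le_ofReal ?_
      have h2 := tail_le (k := k) (N := N) hik (by omega) hp0 hp1
      have h3 := rpow_neg_le_errorTerm k N B
      have h4 := rpow_div_le_errorTerm k N B
      rw [mul_div_assoc]
      have h5 : 8 / p * (N : ℝ) ^ (-(1 / 2 ^ k) : ℝ) ≤ 8 / p * errorTerm k N B := by gcongr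
      linarith
  | succ i ih =>
    obtain ⟨c, C, hc, hC, h⟩ := ih (by omega)
    set p : ℝ := c / (k * (c + k)) with hp
    have hp0 : 0 < p := by positivity
    have hp1 : p ≤ 1 := by rw [hp, div_le_one (by positivity)]; nlinarith
    set A : ℝ := 108 * Real.sqrt (k / (c / k)) with hA
    have hA0 : 0 ≤ A := by positivity
    -- The goodness constant drops from `c` to `p / 4` with `p = c/(k(c+k))`, which stays positive
    -- and depends on `k` and the stage only. The new terms are: exhausted searches, repeated
    -- blocks, too few full draws, and the queries made.
    refine ⟨p / 4, C + (A + 4 * k / (c / k) + 8 / p + A), by positivity, by positivity, ?_⟩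
    intro X Y _ _ _ _ _ F N hN hN16 D hD P hDN B hB
    have hstep := expect_score_succ_le (F := F) (k := k) hD hB
      (good' := P.GoodDatabase (i + 1 + 1) (listSize k N (i + 1 + 1)) (p / 4))
      (mul_nonneg hC (errorTerm_nonneg k N B))
      (b := (A + 4 * k / (c / k) + 8 / p) * errorTerm k N B)
      (q := A * (N : ℝ) ^ sizeExponent k 1)
      (mul_nonneg (by positivity) (errorTerm_nonneg k N B)) (by positivity)
      (h X Y F N hN hN16 D hD P hDN B hB) (fun L hL => ?_) (fun L hL => ?_)
    · refine hstep.trans (ENNReal.ofReal_le_ofReal ?_)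
      have h4 := rpow_div_le_errorTerm k N B
      rw [mul_div_assoc A]
      have h5 : A * ((N : ℝ) ^ sizeExponent k 1 / B) ≤ A * errorTerm k N B := by gcongr
      linarith
    · rw [← hN]
      refine (P.expect_collect_failure_le hD (by omega) hDN (by omega) hc hL hB
        (Λ := 2 ^ ⌈p / 4 * (listSize k N (i + 1 + 1) : ℕ)⌉₊) (by positivity) (failure_le_one _)
        (fun xs hxs hlen hnd => P.failure_goodDatabase_le hL.card_occupied_le _ ?_ ?_ hlen
          hnd)).trans ?_
      · intro x hx x' hx'
        obtain ⟨S, hS, -, hext⟩ := exists_extend_eq_some (Finset.mem_filter.1 (hxs x hx)).2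
        rw [extend_eq_extendInput (hxs x hx), Option.some.injEq] at hext
        rw [hext, Finset.mem_insert] at hx'
        exact hx'.imp_right fun h => ⟨_, hS, h⟩
      · intro x hx
        obtain ⟨S, hS, -, hext⟩ := exists_extend_eq_some (Finset.mem_filter.1 (hxs x hx)).2
        rw [extend_eq_extendInput (hxs x hx), Option.some.injEq] at hext
        rw [hext]
      · refine ENNReal.ofReal_le_ofReal ?_
        have h2 := tail_le (k := k) (N := N) hik (by omega) hp0 hp1
        have h3 := rpow_neg_le_errorTerm k N B
        have h4 := rpow_div_le_errorTerm k N B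
        rw [← hA, mul_div_assoc]
        have h5 : 8 / p * (N : ℝ) ^ (-(1 / 2 ^ k) : ℝ) ≤ 8 / p * errorTerm k N B := by gcongr
        have h6 : A * ((N : ℝ) ^ sizeExponent k 1 / B) ≤ A * errorTerm k N B := by gcongr
        have h7 : 4 * k / (c / k) * (N : ℝ) ^ (-(1 / 2 ^ k) : ℝ) ≤
            4 * k / (c / k) * errorTerm k N B := by gcongr
        linarith
    · rw [← hN]
      exact P.expect_collect_queries_le hD (by omega) hDN (by omega) hc hL B

/-- The last database is built, and all databases cost few queries, with high probability. -/
theorem exists_expect_score_le (k : ℕ) (hk : 1 ≤ k) :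
    ∃ C : ℝ, 0 < C ∧
      ∀ (X : Type u) (Y : Type v) [Fintype X] [Fintype Y] [DecidableEq X] [DecidableEq Y]
        [AddCommGroup Y] (F : X → Y) (N : ℕ), N = Fintype.card Y →
        ∀ (D : Finset X) (hD : D.Nonempty), D.card = k * N →
        ∀ B : ℕ, 0 < B →
          (buildDatabase (Y := Y) k D hD B (k - 1)).expect F (score B fun _ => True) ≤
          ENNReal.ofReal (C * errorTerm k N B) := by
  suffices h : ∃ C : ℝ, 0 ≤ C ∧
      ∀ (X : Type u) (Y : Type v) [Fintype X] [Fintype Y] [DecidableEq X] [DecidableEq Y]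
        [AddCommGroup Y] (F : X → Y) (N : ℕ), N = Fintype.card Y → 16 ≤ N →
        ∀ (D : Finset X) (hD : D.Nonempty), D.card = k * N →
        ∀ B : ℕ, 0 < B →
          (buildDatabase (Y := Y) k D hD B (k - 1)).expect F (score B fun _ => True) ≤
          ENNReal.ofReal (C * errorTerm k N B) by
    obtain ⟨C, hC, h⟩ := h
    -- For `N < 16` the error term is at least `1/N ≥ 1/16`, so the summand `16` makes the bound
    -- trivial.
    refine ⟨C + 16, by positivity, ?_⟩
    intro X Y _ _ _ _ _ F N hN D hD hDN B hB
    have herr := errorTerm_nonneg k N B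
    rcases le_or_gt 16 N with h16 | h16
    · refine (h X Y F N hN h16 D hD hDN B hB).trans (ENNReal.ofReal_le_ofReal ?_)
      nlinarith
    · refine (QProg.expect_le_of_le F _ fun r => score_le_one B _ r).trans ?_
      rw [ENNReal.one_le_ofReal]
      have hN1 : 1 ≤ N := by
        rw [hN]
        exact Fintype.card_pos
      have hN1' : (1 : ℝ) ≤ N := by exact_mod_cast hN1
      have hN16 : (N : ℝ) ≤ 16 := by exact_mod_cast h16.le
      have h1 : (N : ℝ)⁻¹ ≤ (N : ℝ) ^ (-(1 / 2 ^ k) : ℝ) := by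
        rw [← Real.rpow_neg_one]
        refine Real.rpow_le_rpow_of_exponent_le hN1' ?_
        have : 1 / (2 : ℝ) ^ k ≤ 1 := by
          rw [div_le_one (by positivity)]
          exact one_le_pow₀ (by norm_num)
        linarith
      have h2 : (16 : ℝ)⁻¹ ≤ (N : ℝ)⁻¹ := by gcongr
      have h3 := rpow_neg_le_errorTerm k N B
      nlinarith
  obtain ⟨j, rfl⟩ : ∃ j, k = j + 1 := ⟨k - 1, by omega⟩
  rw [Nat.add_sub_cancel]
  cases j with
  | zero =>
    refine ⟨10, by norm_num, ?_⟩
    intro X Y _ _ _ _ _ F N hN hN16 D hD hDN B hB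
    obtain ⟨P⟩ := nonempty_blockPartition F D (k := 0 + 1) (by omega)
    have h1 := P.expect_sampleInputs_failure_le (by omega) hN hN16 hDN
      (Λ := 0) le_rfl (g := failure fun _ => True) (failure_le_one _)
      (fun xs hxs hlen hnd => by simp [failure])
    rw [buildDatabase, ← hN]
    refine (BlockPartition.expect_sampleInputs_score_le (by omega) (by omega) hB ?_ h1).trans ?_
    · rw [zero_mul]
      positivity
    · refine ENNReal.ofReal_le_ofReal ?_
      have h3 := rpow_neg_le_errorTerm (0 + 1) N B
      have h4 := rpow_div_le_errorTerm (0 + 1) N B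
      rw [mul_div_assoc]
      linarith
  | succ i =>
    obtain ⟨c, C, hc, hC, h⟩ := exists_expect_score_goodDatabase_le (i + 1 + 1) i (by omega)
    set k := i + 1 + 1 with hk2
    set A : ℝ := 108 * Real.sqrt (k / (c / k)) with hA
    have hA0 : 0 ≤ A := by positivity
    refine ⟨C + (A + 4 * k / (c / k) + A), by positivity, ?_⟩
    intro X Y _ _ _ _ _ F N hN hN16 D hD hDN B hB
    obtain ⟨P⟩ := nonempty_blockPartition F D (k := k) (by omega)
    have hstep := expect_score_succ_le (F := F) (k := k) hD hB (good' := fun _ => True)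
      (mul_nonneg hC (errorTerm_nonneg k N B))
      (b := (A + 4 * k / (c / k)) * errorTerm k N B)
      (q := A * (N : ℝ) ^ sizeExponent k 1)
      (mul_nonneg (by positivity) (errorTerm_nonneg k N B)) (by positivity)
      (h X Y F N hN hN16 D hD P hDN B hB) (fun L hL => ?_) (fun L hL => ?_)
    · refine hstep.trans (ENNReal.ofReal_le_ofReal ?_)
      have h4 := rpow_div_le_errorTerm k N B
      rw [mul_div_assoc A]
      have h5 : A * ((N : ℝ) ^ sizeExponent k 1 / B) ≤ A * errorTerm k N B := by gcongr
      linarith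
    · rw [← hN]
      -- The last list only has to be completed. Full blocks no longer matter, so `Λ = 0` and there
      -- is no tail term; this is essential, as `t_k = 1` would make that term constant.
      refine (P.expect_collect_failure_le hD (by omega) hDN (by omega) hc hL hB
        (Λ := 0) le_rfl (failure_le_one _) (fun xs hxs hlen hnd => by simp [failure])).trans ?_
      refine ENNReal.ofReal_le_ofReal ?_
      have h3 := rpow_neg_le_errorTerm k N B
      have h4 := rpow_div_le_errorTerm k N B
      rw [← hA, mul_div_assoc]
      have h6 : A * ((N : ℝ) ^ sizeExponent k 1 / B) ≤ A * errorTerm k N B := by gcongr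
      have h7 : 4 * k / (c / k) * (N : ℝ) ^ (-(1 / 2 ^ k) : ℝ) ≤
          4 * k / (c / k) * errorTerm k N B := by gcongr
      linarith
    · rw [← hN]
      exact P.expect_collect_queries_le hD (by omega) hDN (by omega) hc hL B

/-! ### The theorem -/

section Finder

variable {X : Type u} {Y : Type v} [Fintype X] [Fintype Y] [DecidableEq X] [DecidableEq Y]
  [AddCommGroup Y] (F : X → Y) (k : ℕ) (D : Finset X) (hD : D.Nonempty) (B : ℕ)

/-- The cutoff limits the count to the minimum of `B` and the uncut count, which is at most `B`
times the score: after a failure this product is `B`. -/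
theorem expectedQueries_kCollisionFinder_le (hB : 0 < B) :
    (kCollisionFinder (Y := Y) k D B).expectedQueries F ≤
      B * (buildDatabase (Y := Y) k D hD B (k - 1)).expect F (score B fun _ => True) := by
  have hB0 : (B : ℝ≥0∞) ≠ 0 := by exact_mod_cast hB.ne'
  change (kCollisionFinder (Y := Y) k D B).expect F (fun r => (r.2 : ℝ≥0∞)) ≤ _
  rw [kCollisionFinder, dif_pos hD]
  refine (QProg.expect_cutoff_le F B _ (h := fun r => min (B : ℝ≥0∞) r.2) ?_ ?_).trans ?_
  · intro a n hn
    exact le_min (by exact_mod_cast hn) le_rfl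
  · intro a n hn n' hn'
    exact le_min (by exact_mod_cast hn') (by exact_mod_cast hn'.trans hn.le)
  · rw [QProg.expect_bind, ← QProg.expect_const_mul]
    refine QProg.expect_mono F _ fun r _ => ?_
    rw [QProg.expect_ret]
    simp only [zero_add]
    unfold score
    split_ifs
    · rcases le_total 1 ((r.2 : ℝ≥0∞) / B) with h | h
      · rw [min_eq_left h, mul_one]
        exact min_le_left _ _
      · rw [min_eq_right h, ENNReal.mul_div_cancel hB0 (ENNReal.natCast_ne_top _)]
        exact min_le_right _ _
    · rw [mul_one]
      exact min_le_left _ _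

/-- A completed `L_k` has a single entry, which is a `k`-collision. So the algorithm fails only if
the uncut run does not complete `L_k` or exceeds the budget, and the score is `1` in both cases. -/
theorem le_successProb_kCollisionFinder (hk : 1 ≤ k) (hB : 0 < B) :
    1 - (buildDatabase (Y := Y) k D hD B (k - 1)).expect F (score B fun _ => True) ≤
      (kCollisionFinder (Y := Y) k D B).successProb F k := by
  classical
  have hB0 : (B : ℝ≥0∞) ≠ 0 := by exact_mod_cast hB.ne'
  have hsucc : (kCollisionFinder (Y := Y) k D B).successProb F k =
      (kCollisionFinder (Y := Y) k D B).expect F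
        (fun r => if ∃ S, r.1 = some S ∧ IsKCollision F k S then 1 else 0) := by
    unfold QProg.successProb QProg.expect pmfExpect
    rw [PMF.toOuterMeasure_apply]
    refine tsum_congr fun r => ?_
    by_cases h : ∃ S, r.1 = some S ∧ IsKCollision F k S <;> simp [Set.indicator, h]
  have hfail : (kCollisionFinder (Y := Y) k D B).expect F
      (fun r => if ∃ S, r.1 = some S ∧ IsKCollision F k S then 0 else 1) ≤
      (buildDatabase (Y := Y) k D hD B (k - 1)).expect F (score B fun _ => True) := by
    rw [kCollisionFinder, dif_pos hD]
    refine (QProg.expect_cutoff_le F B _ (h := fun r =>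
      if (∃ S, r.1 = some S ∧ IsKCollision F k S) ∧ r.2 ≤ B then 0 else 1) ?_ ?_).trans ?_
    · intro a n hn
      simp [hn]
    · intro a n hn n' hn'
      simp [not_le.2 hn]
    · rw [QProg.expect_bind]
      refine QProg.expect_mono F _ fun r hr => ?_
      rw [QProg.expect_ret]
      simp only [zero_add]
      by_cases h2 : ∃ L, r.1 = some L ∧ True
      · rw [score, if_pos h2]
        obtain ⟨L, hL, -⟩ := h2
        have hlist := buildDatabase_support k hD B (k - 1) r hr L hL
        rw [Nat.sub_add_cancel hk, listSize_self] at hlist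
        obtain ⟨hlen, -, hcol⟩ := hlist
        obtain ⟨e, rfl⟩ := List.length_eq_one_iff.1 hlen
        split_ifs with h1
        · exact zero_le
        have hlt : B < r.2 := by
          by_contra hle
          refine h1 ⟨⟨e.1, ?_, (hcol e (by simp)).1⟩, not_lt.1 hle⟩
          simp [hL]
        refine le_min le_rfl ?_
        rw [ENNReal.le_div_iff_mul_le (Or.inl hB0) (Or.inl (ENNReal.natCast_ne_top _)), one_mul]
        exact_mod_cast hlt.le
      · rw [score, if_neg h2]
        split_ifs <;> simp
  have hone : (kCollisionFinder (Y := Y) k D B).successProb F k +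
      (kCollisionFinder (Y := Y) k D B).expect F
        (fun r => if ∃ S, r.1 = some S ∧ IsKCollision F k S then 0 else 1) = 1 := by
    rw [hsucc, ← QProg.expect_add]
    refine Eq.trans ?_ (QProg.expect_const F (kCollisionFinder (Y := Y) k D B) 1)
    congr 1
    funext r
    split_ifs <;> simp
  rw [tsub_le_iff_right, ← hone]
  gcongr

end Finder

end

end MultiCollision

theorem mainTheorem2 (k : ℕ) (hk : 1 ≤ k) :
    ∃ C : ℝ, 0 < C ∧
      ∀ (X : Type u) (Y : Type v) [Fintype X] [Fintype Y] [DecidableEq X] [DecidableEq Y]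
        [AddCommGroup Y] (F : X → Y) (N : ℕ), N = Fintype.card Y → k * N ≤ Fintype.card X →
        ∀ D : Finset X, D.card = k * N →
          -- overwhelming success probability with `O(N ^ e)` expected queries
          (∀ B : ℕ, B = ⌈(N : ℝ) ^ (MultiCollision.queryExponent k + 1 / 2 ^ k)⌉₊ →
            (MultiCollision.kCollisionFinder (Y := Y) k D B).expectedQueries F
              ≤ ENNReal.ofReal (C * (N : ℝ) ^ MultiCollision.queryExponent k) ∧
            ENNReal.ofReal (1 - C * (N : ℝ) ^ (-(1 / 2 ^ k) : ℝ))
              ≤ (MultiCollision.kCollisionFinder (Y := Y) k D B).successProb F k) ∧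
          -- a fixed number `A * N ^ e` of queries
          (∀ A : ℝ, 1 ≤ A → ∀ B : ℕ, B = ⌈A * (N : ℝ) ^ MultiCollision.queryExponent k⌉₊ →
            (∀ r ∈ ((MultiCollision.kCollisionFinder (Y := Y) k D B).dist F).support, r.2 ≤ B) ∧
            ENNReal.ofReal (1 - C / A - C * (N : ℝ) ^ (-(1 / 2 ^ k) : ℝ))
              ≤ (MultiCollision.kCollisionFinder (Y := Y) k D B).successProb F k) ∧
          -- the databases consist of `t_i` distinct `i`-collisions
          (∀ (hD : D.Nonempty) (R i : ℕ), i < k →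
            ∀ r ∈ ((MultiCollision.buildDatabase (Y := Y) k D hD R i).dist F).support,
              ∀ L : MultiCollision.Database X Y, r.1 = some L →
                MultiCollision.IsCollisionList F (i + 1)
                  (MultiCollision.listSize k N (i + 1)) L) := by
  obtain ⟨C, hC, h⟩ := MultiCollision.exists_expect_score_le.{u, v} k hk
  -- The `3` comes from the expected queries: `B δ ≤ 2 N^e`, where the `2` pays for rounding up `B`,
  -- and another `N^e` from the second part of the error term.
  refine ⟨3 * C, by positivity, ?_⟩
  intro X Y _ _ _ _ _ F N hN _ D hDN
  have hN1 : 1 ≤ N := by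
    rw [hN]
    exact Fintype.card_pos
  have hN1' : (1 : ℝ) ≤ N := by exact_mod_cast hN1
  have hN0 : (0 : ℝ) < N := by linarith
  have hD : D.Nonempty := by
    rw [← Finset.card_pos, hDN]
    exact Nat.mul_pos hk hN1
  have he : MultiCollision.queryExponent k = MultiCollision.sizeExponent k 1 := rfl
  set e := MultiCollision.sizeExponent k 1 with hedef
  set δ : ℝ := (N : ℝ) ^ (-(1 / 2 ^ k) : ℝ) with hδ
  have hδ0 : 0 < δ := Real.rpow_pos_of_pos hN0 _
  have hNe : 0 < (N : ℝ) ^ e := Real.rpow_pos_of_pos hN0 _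
  rw [he]
  have hsuccess : ∀ B : ℕ, 0 < B → ∀ x : ℝ, C * MultiCollision.errorTerm k N B ≤ x →
      ENNReal.ofReal (1 - x) ≤ (MultiCollision.kCollisionFinder (Y := Y) k D B).successProb F k := by
    intro B hB x hx
    refine le_trans ?_ (MultiCollision.le_successProb_kCollisionFinder F k D hD B hk hB)
    have hx0 : 0 ≤ x :=
      (mul_nonneg hC.le (MultiCollision.errorTerm_nonneg k N B)).trans hx
    rw [ENNReal.ofReal_sub _ hx0, ENNReal.ofReal_one]
    exact tsub_le_tsub_left ((h X Y F N hN D hD hDN B hB).trans (ENNReal.ofReal_le_ofReal hx)) _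
  refine ⟨?_, ?_, ?_⟩
  · intro B hBdef
    -- The reason for the exponent of `B`: a failure of probability `O(δ)` may use up the budget,
    -- and `Bδ` is of order `N^e`; at the same time `N^e / B ≤ δ`.
    have hpow : (N : ℝ) ^ (e + 1 / 2 ^ k) * δ = (N : ℝ) ^ e := by
      rw [hδ, ← Real.rpow_add hN0]
      congr 1
      ring
    have hpow0 : 0 < (N : ℝ) ^ (e + 1 / 2 ^ k) := Real.rpow_pos_of_pos hN0 _
    have hpow1 : 1 ≤ (N : ℝ) ^ (e + 1 / 2 ^ k) := by
      refine Real.one_le_rpow hN1' ?_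
      have := MultiCollision.sizeExponent_nonneg 1 hk
      positivity
    have hB : 0 < B := by
      rw [hBdef]
      exact Nat.ceil_pos.2 hpow0
    have hB' : (0 : ℝ) < B := by exact_mod_cast hB
    have hBge : (N : ℝ) ^ (e + 1 / 2 ^ k) ≤ B := by
      rw [hBdef]
      exact Nat.le_ceil _
    have hBle : (B : ℝ) ≤ 2 * (N : ℝ) ^ (e + 1 / 2 ^ k) := by
      rw [hBdef]
      have := (Nat.ceil_lt_add_one hpow0.le).le
      linarith
    constructor
    · refine (MultiCollision.expectedQueries_kCollisionFinder_le F k D hD B hB).trans ?_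
      refine (mul_le_mul_right (h X Y F N hN D hD hDN B hB) _).trans ?_
      rw [← ENNReal.ofReal_natCast, ← ENNReal.ofReal_mul hB'.le]
      refine ENNReal.ofReal_le_ofReal ?_
      have h1 : (B : ℝ) * (C * MultiCollision.errorTerm k N B) =
          C * (B * δ + (N : ℝ) ^ e) := by
        simp only [MultiCollision.errorTerm, ← hδ, ← hedef]
        field_simp
      have h2 : (B : ℝ) * δ ≤ 2 * (N : ℝ) ^ e := by
        rw [← hpow, ← mul_assoc]
        gcongr
      rw [h1]
      nlinarith
    · refine hsuccess B hB _ ?_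
      have h1 : (N : ℝ) ^ e / B ≤ δ := by
        rw [div_le_iff₀ hB', ← hpow, mul_comm]
        gcongr
      have h2 : MultiCollision.errorTerm k N B ≤ 2 * δ := by
        unfold MultiCollision.errorTerm
        linarith
      nlinarith
  · intro A hA B hBdef
    have hA0 : 0 < A := by linarith
    have hB : 0 < B := by
      rw [hBdef]
      exact Nat.ceil_pos.2 (by positivity)
    have hB' : (0 : ℝ) < B := by exact_mod_cast hB
    refine ⟨?_, ?_⟩
    · rw [MultiCollision.kCollisionFinder, dif_pos hD]
      exact MultiCollision.QProg.cutoff_queries_le F B _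
    · rw [sub_sub]
      refine hsuccess B hB _ ?_
      have hBge : A * (N : ℝ) ^ e ≤ B := by
        rw [hBdef]
        exact Nat.le_ceil _
      have h1 : (N : ℝ) ^ e / B ≤ 1 / A := by
        rw [div_le_div_iff₀ hB' hA0]
        linarith
      have h2 : MultiCollision.errorTerm k N B ≤ δ + 1 / A := by
        unfold MultiCollision.errorTerm
        linarith
      have h3 : 0 < 1 / A := by positivity
      rw [show 3 * C / A = 3 * C * (1 / A) by ring]
      nlinarith
  · intro hD R i _ r hr L hL
    rw [hN]
    exact MultiCollision.buildDatabase_support k hD R i r hr L hL
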